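/- Let $\rho$ be either $\tanh$ or the logistic function $\rho(t)=1/(1+e^{-t})$. For integers $d\ge 1$, $L\ge 2$, $n_L\ge 1$ and a real number $R\ge 1$, let $\mathcal U=\mathcal N_\rho(L,n_L,R)$ be the set of functions $u_\theta:\mathbb R^d\to\mathbb R$ computed by fully connected feedforward networks of depth $L$ (i.e. $u^{(0)}(x)=x$, $u^{(\ell)}=\rho(W^{(\ell)}u^{(\ell-1)}+b^{(\ell)})$ for $1\le\ell\le L-1$, $u_\theta=W^{(L)}u^{(L-1)}+b^{(L)}$, with arbitrary hidden widths) having at most $n_L$ nonzero parameters (entries of the weight matrices and bias vectors), all bounded by $R$ in absolute value. Let $\Omega\subset\mathbb R^d$ be a smooth domain such that $\Omega$ has finite volume and $\partial\Omega$ has finite positive surface measure; let $f\in L^\infty(\Omega)$, $g\in L^\infty(\partial\Omega)$, and $$\mathcal F_i=\{(\Delta u_\theta+f)^2:\ u_\theta\in\mathcal U\},\qquad \mathcal F_b=\{|u_\theta-g|^2:\ u_\theta\in\mathcal U\}.$$ For a class $\mathcal F$ of real functions on $\Omega$ (resp. $\partial\Omega$), its Rademacher complexity is $$\mathcal R_n(\mathcal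 F)=\mathbb E_{\xi,\omega}\Big[\sup_{v\in\mathcal F}\frac1n\sum_{j=1}^n\omega_j v(\xi_j)\Big],$$ where $\xi_1,\dots,\xi_n$ are i.i.d. uniformly distributed on $\Omega$ (resp. $\partial\Omega$) and $\omega_1,\dots,\omega_n$ are i.i.d. uniform on $\{1,-1\}$, independent of $\xi$. For every $C_0>0$ there are constants $c=c(d,\|f\|_{L^\infty(\Omega)})$ and $\tilde c=\tilde c(d,\|g\|_{L^\infty(\partial\Omega)})$, bounded by polynomials in their arguments (and otherwise depending only on $C_0$), such that whenever $2\le L\le C_0\log(d+3)$ the expectations below are well defined (almost surely finite, integrable suprema), and for all integers $n,m\ge1$ $$\mathcal R_n(\mathcal F_i)\le c\,n^{-\frac12}\,n_L^{4L-\frac72}R^{4L}\big(\log^{\frac12}R+\log^{\frac12}n_L+\log^{\frac12}n\big),$$ $$\mathcal R_m(\mathcal F_b)\le \tilde c\,m^{-\frac12}\,R^2\,n_L^{\frac52}\big(\log^{\frac12}R+\log^{\frac12}n_L+\log^{\frac12}m\big),$$ where in the second bound $n_L$ and $m$ are not both equal to $1$. -/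

import Mathlib

open MeasureTheory ProbabilityTheory

noncomputable section

/-- Parameters `θ` (weight matrices and bias vectors) of a fully connected feedforward network
`ℝᵈ → ℝ`; `DNN L d` is the type of parameters of networks of depth `L` (that is, `L` affine maps,
an activation being applied after each of them except the last one) with input dimension `d`.
The hidden widths are arbitrary. -/
inductive DNN : ℕ → ℕ → Type
  /-- the output layer `x ↦ W x + b`, a network of depth `1` -/
  | output {d : ℕ} (W : Matrix (Fin 1) (Fin d) ℝ) (b : Fin 1 → ℝ) : DNN 1 d
  /-- a hidden layer `x ↦ ρ (W x + b)` of width `k`, followed by the remaining layers -/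
  | hidden {L d k : ℕ} (W : Matrix (Fin k) (Fin d) ℝ) (b : Fin k → ℝ) (rest : DNN L k) :
      DNN (L + 1) d

namespace DNN

/-- The function computed by the network, `ρ` being applied componentwise. -/
def eval (ρ : ℝ → ℝ) : {L d : ℕ} → DNN L d → (Fin d → ℝ) → ℝ
  | _, _, output W b, x => (W.mulVec x + b) 0
  | _, _, hidden W b rest, x => rest.eval ρ (fun i => ρ ((W.mulVec x + b) i))

/-- The number of nonzero entries of one layer (weight matrix and bias vector). -/
def layerNonzeros {k d : ℕ} (W : Matrix (Fin k) (Fin d) ℝ) (b : Fin k → ℝ) : ℕ :=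
  {p : Fin k × Fin d | W p.1 p.2 ≠ 0}.ncard + {i : Fin k | b i ≠ 0}.ncard

/-- The total number of nonzero parameters of the network. -/
def numNonzeros : {L d : ℕ} → DNN L d → ℕ
  | _, _, output W b => layerNonzeros W b
  | _, _, hidden W b rest => layerNonzeros W b + rest.numNonzeros

/-- All parameters are bounded by `R` in absolute value, `|θ|_{ℓ^∞} ≤ R`. -/
def BoundedBy (R : ℝ) : {L d : ℕ} → DNN L d → Prop
  | _, _, output W b => (∀ i j, |W i j| ≤ R) ∧ ∀ i, |b i| ≤ R
  | _, _, hidden W b rest => ((∀ i j, |W i j| ≤ R) ∧ ∀ i, |b i| ≤ R) ∧ rest.BoundedBy R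

end DNN

/-- The class `𝒩_ρ(L, n_L, R)` of functions `u_θ : ℝᵈ → ℝ` computed by networks with activation
`ρ`, depth `L`, any widths, at most `nL` nonzero parameters, all of them bounded by `R`. -/
def nnClass (ρ : ℝ → ℝ) (d L nL : ℕ) (R : ℝ) : Set (EuclideanSpace ℝ (Fin d) → ℝ) :=
  {u | ∃ θ : DNN L d, θ.numNonzeros ≤ nL ∧ θ.BoundedBy R ∧ u = fun x => θ.eval ρ (fun i => x i)}

/-- The class `𝓕ᵢ` of the functions `(Δ u + f)²`, `u ∈ U`. -/
def interiorClass {d : ℕ} (U : Set (EuclideanSpace ℝ (Fin d) → ℝ))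
    (f : EuclideanSpace ℝ (Fin d) → ℝ) : Set (EuclideanSpace ℝ (Fin d) → ℝ) :=
  {l | ∃ u ∈ U, l = fun x => (Laplacian.laplacian u x + f x) ^ 2}

/-- The class `𝓕_b` of the functions `|u - g|²`, `u ∈ U`. -/
def boundaryClass {d : ℕ} (U : Set (EuclideanSpace ℝ (Fin d) → ℝ))
    (g : EuclideanSpace ℝ (Fin d) → ℝ) : Set (EuclideanSpace ℝ (Fin d) → ℝ) :=
  {l | ∃ u ∈ U, l = fun x => |u x - g x| ^ 2}

/-- The surface measure in `ℝᵈ`, up to a normalization that the uniform distribution ignores: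
the `(d-1)`-dimensional Hausdorff measure. -/
def surfaceMeasure (d : ℕ) : Measure (EuclideanSpace ℝ (Fin d)) :=
  Measure.hausdorffMeasure ((d : ℝ) - 1)

/-- The uniform distribution on `Ω`, i.e. Lebesgue measure conditioned on `Ω`. -/
def uniformInterior {d : ℕ} (Ω : Set (EuclideanSpace ℝ (Fin d))) :
    Measure (EuclideanSpace ℝ (Fin d)) :=
  ProbabilityTheory.cond volume Ω

/-- The uniform distribution on `∂Ω`, i.e. surface measure conditioned on `∂Ω`. -/
def uniformBoundary {d : ℕ} (Ω : Set (EuclideanSpace ℝ (Fin d))) :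
    Measure (EuclideanSpace ℝ (Fin d)) :=
  ProbabilityTheory.cond (surfaceMeasure d) (frontier Ω)

/-- The values `n⁻¹ ∑ⱼ ωⱼ v(ξⱼ)`, `v ∈ F`, for given signs `ω` and a given sample `ξ`. -/
def rademacherSums {X : Type*} (F : Set (X → ℝ)) {n : ℕ} (ω : Fin n → ℤˣ) (ξ : Fin n → X) :
    Set ℝ :=
  (fun v : X → ℝ => (1 / (n : ℝ)) * ∑ j, (((ω j : ℤˣ) : ℤ) : ℝ) * v (ξ j)) '' F

/-- The Rademacher complexity `𝓡ₙ(F) = 𝔼_{ξ,ω} [sup_{v ∈ F} n⁻¹ ∑ⱼ ωⱼ v(ξⱼ)]`, where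
`ξ₁, …, ξₙ` are i.i.d. with law `μ` and the signs `ω₁, …, ωₙ` are i.i.d. uniform on `{1, -1}` and
independent of `ξ`: each of the `2ⁿ` sign vectors has probability `2⁻ⁿ`. -/
def rademacherComplexity {X : Type*} [MeasurableSpace X] (μ : Measure X) (n : ℕ)
    (F : Set (X → ℝ)) : ℝ :=
  ∫ ξ : Fin n → X, (1 / (2 : ℝ) ^ n) * ∑ ω : Fin n → ℤˣ, sSup (rademacherSums F ω ξ)
    ∂(Measure.pi fun _ : Fin n => μ)

/-- The supremum and the expectation in the Rademacher complexity are meaningful: the supremum is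
almost surely finite and it is an integrable function of the sample. -/
def RademacherWellDefined {X : Type*} [MeasurableSpace X] (μ : Measure X) (n : ℕ)
    (F : Set (X → ℝ)) : Prop :=
  ∀ ω : Fin n → ℤˣ,
    (∀ᵐ ξ ∂(Measure.pi fun _ : Fin n => μ), BddAbove (rademacherSums F ω ξ)) ∧
    Integrable (fun ξ : Fin n → X => sSup (rademacherSums F ω ξ))
      (Measure.pi fun _ : Fin n => μ)

/-- The norm `‖f‖_{L^∞(Ω)}`. -/
def normInterior {d : ℕ} (Ω : Set (EuclideanSpace ℝ (Fin d))) (f : EuclideanSpace ℝ (Fin d) → ℝ) :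
    ℝ :=
  (eLpNorm f ⊤ (volume.restrict Ω)).toReal

/-- The norm `‖g‖_{L^∞(∂Ω)}`. -/
def normBoundary {d : ℕ} (Ω : Set (EuclideanSpace ℝ (Fin d))) (g : EuclideanSpace ℝ (Fin d) → ℝ) :
    ℝ :=
  (eLpNorm g ⊤ ((surfaceMeasure d).restrict (frontier Ω))).toReal

/-- A constant `c(d, t)` depends on `d` and `t ≥ 0` at most polynomially. -/
def PolynomialDependence (c : ℕ → ℝ → ℝ) : Prop :=
  ∃ (A : ℝ) (k : ℕ), ∀ (d : ℕ) (t : ℝ), 0 ≤ t → c d t ≤ A * (1 + (d : ℝ) + t) ^ k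

end

/-! For a fixed sample, a finite net of the class at the sample points, at scale `1 / n`, reduces
the Rademacher average to a maximum over finitely many vectors, to which Massart's lemma applies. If
the residual is bounded by `G` and the net has at most `Y ^ N` elements, the complexity is at most
`1 / n + G ^ 2 * √(2 * n * N * log Y) / n`. It remains to show that `log Y` is logarithmic in `N * R
* n`, and that `G` has the right power of `N` and `R`.

The difficulty is that `Ω` and its boundary may be unbounded, so the first pre-activation is not
Lipschitz in the parameters uniformly in `x`. The net is therefore built from the values of the
first hidden layer at the sample. Such a value is a monotone function of a linear form in the
parameters, however large `x` is. Comparing these values with a grid of thresholds gives sign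
patterns of linear forms; for a fixed support of size at most `N` their VC dimension is at most `N`
(`card_patterns_le`), and Sauer–Shelah counts them (`exists_cover_sparse`). The same net controls
every parameter.

Beyond the first layer everything is Lipschitz: for tanh and the logistic function, `ρ'` and `ρ''`
are polynomials in `ρ`, so closeness of activations implies closeness of their derivatives.
Propagating value, first and second directional derivative (a jet) through the layers bounds the
Laplacian and its dependence on the net (`jetBdd_jetRun`, `jetClose_netJet`). Sparsity allows every
hidden layer to have width `N` (`DNN.exists_padded`), so the number of parameters is polynomial in
`N`, `d` and the depth. -/

/-! ### Sign patterns of linear forms and nets of sparse vectors -/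

theorem sum_choose_le_pow (m N : ℕ) : ∑ k ∈ Finset.Iic N, m.choose k ≤ (m + 1) ^ N := by
  rw [add_pow, Nat.range_succ_eq_Iic]
  refine Finset.sum_le_sum fun k hk => ?_
  have h1 : 1 ≤ N.choose k := Nat.choose_pos (Finset.mem_Iic.1 hk)
  calc m.choose k ≤ m ^ k := Nat.choose_le_pow m k
    _ = m ^ k * 1 ^ (N - k) * 1 := by simp
    _ ≤ _ := by gcongr; exact_mod_cast h1

/-- Sign patterns of finitely many linear forms, with respect to upper sets of `ℝ`, have small
Vapnik–Chervonenkis dimension. -/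
theorem card_patterns_le {P ι : Type*} [Fintype P] [DecidableEq P] [Fintype ι]
    (c : P → ι → ℝ) (U : P → Set ℝ) (hU : ∀ p, IsUpperSet (U p)) (𝒜 : Finset (Finset P))
    (h𝒜 : ∀ E ∈ 𝒜, ∃ a : ι → ℝ, ∀ p, p ∈ E ↔ ∑ q, c p q * a q ∈ U p) :
    𝒜.card ≤ (Fintype.card P + 1) ^ Fintype.card ι := by
  have hvc : 𝒜.vcDim ≤ Fintype.card ι := by
    refine Finset.sup_le fun S hS => ?_
    rw [Finset.mem_shatterer] at hS
    by_contra! hlt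
    -- A shattered set with more points than variables carries a linear relation `g` among its
    -- forms. Realizing the patterns `{g > 0}` and `{g < 0}` will contradict it.
    have hnl : ¬ LinearIndependent ℝ (fun p : S => c p) := fun hli => by
      have := hli.fintype_card_le_finrank
      simp at this
      omega
    obtain ⟨g, hg, ⟨p₀, hp₀⟩⟩ := Fintype.not_linearIndependent_iff.1 hnl
    have key : ∀ a : ι → ℝ, ∑ p : S, g p * ∑ q, c p q * a q = 0 := fun a => by
      have h2 : ∀ q, ∑ p : S, g p * c p q = 0 := fun q => by
        simpa using congrFun hg q
      simp_rw [Finset.mul_sum]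
      rw [Finset.sum_comm]
      refine Finset.sum_eq_zero fun q _ => ?_
      simp_rw [← mul_assoc, ← Finset.sum_mul, h2, zero_mul]
    classical
    obtain ⟨E₁, hE₁, h₁⟩ := hS (t := (Finset.univ.filter fun p : S => 0 < g p).image Subtype.val)
      (by intro x hx; simp at hx; exact hx.1)
    obtain ⟨E₂, hE₂, h₂⟩ := hS (t := (Finset.univ.filter fun p : S => g p < 0).image Subtype.val)
      (by intro x hx; simp at hx; exact hx.1)
    obtain ⟨a, ha⟩ := h𝒜 E₁ hE₁
    obtain ⟨b, hb⟩ := h𝒜 E₂ hE₂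
    have m₁ : ∀ p : S, (p : P) ∈ E₁ ↔ 0 < g p := fun p => by
      have := Finset.ext_iff.1 h₁ p
      simpa using this
    have m₂ : ∀ p : S, (p : P) ∈ E₂ ↔ g p < 0 := fun p => by
      have := Finset.ext_iff.1 h₂ p
      simpa using this
    -- Where `g p > 0`, the form lies in the upper set at `a` but not at `b`, so its value at `a` is
    -- larger; where `g p < 0` the roles are exchanged. Either way, the weighted difference is
    -- positive.
    have hpos : ∀ p : S, g p ≠ 0 →
        0 < g p * ∑ q, c p q * a q - g p * ∑ q, c p q * b q := fun p hp => by
      rcases lt_or_gt_of_ne hp with h | h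
      · have hin := (hb p).1 ((m₂ p).2 h)
        have hout : ∑ q, c p q * a q ∉ U p := fun hh =>
          absurd ((m₁ p).1 ((ha p).2 hh)) (not_lt.2 h.le)
        have : ∑ q, c p q * a q < ∑ q, c p q * b q := by
          by_contra! hle
          exact hout (hU p hle hin)
        nlinarith
      · have hin := (ha p).1 ((m₁ p).2 h)
        have hout : ∑ q, c p q * b q ∉ U p := fun hh =>
          absurd ((m₂ p).1 ((hb p).2 hh)) (not_lt.2 h.le)
        have : ∑ q, c p q * b q < ∑ q, c p q * a q := by
          by_contra! hle
          exact hout (hU p hle hin)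
        nlinarith
    have hs : 0 < ∑ p : S, (g p * ∑ q, c p q * a q - g p * ∑ q, c p q * b q) := by
      refine Finset.sum_pos' (fun p _ => ?_) ⟨p₀, Finset.mem_univ _, hpos p₀ hp₀⟩
      by_cases hp : g p = 0
      · simp [hp]
      · exact (hpos p hp).le
    rw [Finset.sum_sub_distrib, key a, key b] at hs
    simp at hs
  calc 𝒜.card ≤ _ := 𝒜.card_le_card_shatterer
    _ ≤ _ := Finset.card_shatterer_le_sum_vcDim
    _ ≤ _ := sum_choose_le_pow _ _
    _ ≤ _ := Nat.pow_le_pow_right (by omega) hvc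

/-- Covering of a bounded set of sparse vectors, uniformly in finitely many monotone functions of
linear forms. -/
theorem exists_cover_sparse {I Q : Type*} [Fintype I] [DecidableEq I] [Fintype Q] [DecidableEq Q]
    (c : Q → I → ℝ) (σ : Q → ℝ → ℝ) (hσ : ∀ q, Monotone (σ q)) (A : Set (I → ℝ)) (N : ℕ)
    (hN : ∀ p ∈ A, (Finset.univ.filter fun i => p i ≠ 0).card ≤ N) (R δ : ℝ) (hδ : 0 < δ) (K : ℕ)
    (hK : R ≤ K * δ) (hR : ∀ p ∈ A, ∀ q, |σ q (∑ i, c q i * p i)| ≤ R) :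
    ∃ T : Finset (I → ℝ), (T : Set (I → ℝ)) ⊆ A ∧
      T.card ≤ ((Fintype.card I + 1) * (Fintype.card Q * (2 * K + 1) + 1)) ^ N ∧
      ∀ p ∈ A, ∃ p' ∈ T, ∀ q,
        |σ q (∑ i, c q i * p i) - σ q (∑ i, c q i * p' i)| ≤ δ := by
  classical
  let supp : (I → ℝ) → Finset I := fun p => Finset.univ.filter fun i => p i ≠ 0
  -- The thresholds are `-K * δ, ..., K * δ`, shifted by `K` to be indexed from `0`. Preimages of
  -- half-lines under a monotone function are upper sets, so no inverse of `σ` is needed.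
  let U : Q × Fin (2 * K + 1) → Set ℝ := fun s => {z | (((s.2 : ℕ) : ℝ) - K) * δ ≤ σ s.1 z}
  have hU : ∀ s, IsUpperSet (U s) := fun s y z hyz hy => le_trans hy (hσ s.1 hyz)
  let pat : (I → ℝ) → Finset (Q × Fin (2 * K + 1)) := fun p =>
    Finset.univ.filter fun s => ∑ i, c s.1 i * p i ∈ U s
  let code : (I → ℝ) → (Σ _ : Finset I, Finset (Q × Fin (2 * K + 1))) := fun p => ⟨supp p, pat p⟩
  -- The largest grid point below the value at `p` is also below the value at `p'`, by equality of
  -- the patterns.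
  have hclose : ∀ p ∈ A, ∀ p' ∈ A, pat p = pat p' → ∀ q,
      σ q (∑ i, c q i * p i) - σ q (∑ i, c q i * p' i) ≤ δ := by
    intro p hp p' hp' h q
    by_contra! hlt
    set y := σ q (∑ i, c q i * p i)
    set y' := σ q (∑ i, c q i * p' i)
    have hy := abs_le.1 (hR p hp q)
    have hy' := abs_le.1 (hR p' hp' q)
    have hf1 : (⌊y / δ⌋ : ℝ) * δ ≤ y := by
      rw [← le_div_iff₀ hδ]; exact Int.floor_le _
    have hf2 : y < ((⌊y / δ⌋ : ℝ) + 1) * δ := by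
      rw [← div_lt_iff₀ hδ]; exact Int.lt_floor_add_one _
    have hk1 : -(K : ℤ) ≤ ⌊y / δ⌋ := by
      rw [Int.le_floor]; push_cast
      rw [le_div_iff₀ hδ]; nlinarith [hy.1]
    have hk2 : ⌊y / δ⌋ ≤ (K : ℤ) := by
      have : y / δ ≤ K := by rw [div_le_iff₀ hδ]; exact hy.2.trans hK
      exact_mod_cast (Int.floor_le _).trans this
    obtain ⟨k, hk⟩ := Int.eq_ofNat_of_zero_le (show 0 ≤ ⌊y / δ⌋ + K by omega)
    have hkK : k < 2 * K + 1 := by omega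
    have hkr : (k : ℝ) - K = ⌊y / δ⌋ := by
      have : (⌊y / δ⌋ : ℤ) = (k : ℤ) - K := by omega
      rw [this]; push_cast; ring
    have hmem : (q, (⟨k, hkK⟩ : Fin (2 * K + 1))) ∈ pat p := by
      simp only [pat, U, Finset.mem_filter, Finset.mem_univ, true_and, Set.mem_ofPred_eq]
      rw [hkr]; exact hf1
    rw [h] at hmem
    simp only [pat, U, Finset.mem_filter, Finset.mem_univ, true_and, Set.mem_ofPred_eq] at hmem
    rw [hkr] at hmem
    change _ ≤ y' at hmem
    nlinarith
  let 𝒮 : Finset (Finset I) := Finset.univ.filter fun S => S.card ≤ N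
  let ℰ : Finset I → Finset (Finset (Q × Fin (2 * K + 1))) := fun S =>
    Finset.univ.filter fun E => ∃ p ∈ A, supp p = S ∧ pat p = E
  let C := 𝒮.sigma ℰ
  have hcode : ∀ p ∈ A, code p ∈ C := fun p hp => by
    simp only [C, code, Finset.mem_sigma, 𝒮, ℰ, Finset.mem_filter, Finset.mem_univ, true_and]
    exact ⟨hN p hp, p, hp, rfl, rfl⟩
  have hC : ∀ s ∈ C, ∃ p ∈ A, code p = s := by
    rintro ⟨S, E⟩ hs
    simp only [C, Finset.mem_sigma, 𝒮, ℰ, Finset.mem_filter, Finset.mem_univ, true_and] at hs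
    obtain ⟨-, p, hp, h1, h2⟩ := hs
    exact ⟨p, hp, by simp only [code, h1, h2]⟩
  -- Representatives of the codes are taken in `A` itself, so the net is internal.
  choose! r hrA hr using hC
  have h𝒮 : 𝒮.card ≤ (Fintype.card I + 1) ^ N := by
    refine le_trans ?_ (sum_choose_le_pow _ _)
    have : 𝒮 ⊆ (Finset.Iic N).biUnion fun k => Finset.powersetCard k Finset.univ := by
      intro S hS
      simp only [𝒮, Finset.mem_filter, Finset.mem_univ, true_and] at hS
      simp [hS]
    refine (Finset.card_le_card this).trans (Finset.card_biUnion_le.trans ?_)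
    simp
  have hℰ : ∀ S ∈ 𝒮, (ℰ S).card ≤ (Fintype.card Q * (2 * K + 1) + 1) ^ N := by
    intro S hS
    simp only [𝒮, Finset.mem_filter, Finset.mem_univ, true_and] at hS
    -- Once the support `S` is fixed, the forms depend on only `S.card ≤ N` variables, whence the
    -- exponent `N`.
    have := card_patterns_le (fun (s : Q × Fin (2 * K + 1)) (i : S) => c s.1 i) U hU (ℰ S) (by
      intro E hE
      simp only [ℰ, Finset.mem_filter, Finset.mem_univ, true_and] at hE
      obtain ⟨p, hp, h1, rfl⟩ := hE
      refine ⟨fun i => p i, fun s => ?_⟩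
      have : ∑ i : S, c s.1 i * p i = ∑ i, c s.1 i * p i := by
        rw [Finset.sum_coe_sort S (fun i => c s.1 i * p i)]
        refine Finset.sum_subset (Finset.subset_univ _) fun i _ hi => ?_
        have : p i = 0 := by
          by_contra hne
          exact hi (h1 ▸ (by simpa [supp] using hne))
        simp [this]
      rw [this]
      simp [pat])
    simp only [Fintype.card_prod, Fintype.card_fin, Fintype.card_coe] at this
    exact this.trans (Nat.pow_le_pow_right (by omega) hS)
  refine ⟨C.image r, ?_, ?_, ?_⟩
  · intro p hp
    simp only [Finset.coe_image, Set.mem_image, Finset.mem_coe] at hp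
    obtain ⟨s, hs, rfl⟩ := hp
    exact hrA s hs
  · refine Finset.card_image_le.trans ?_
    rw [Finset.card_sigma, mul_pow]
    refine (Finset.sum_le_sum hℰ).trans ?_
    rw [Finset.sum_const, smul_eq_mul]
    gcongr
  · intro p hp
    refine ⟨r (code p), Finset.mem_image_of_mem _ (hcode p hp), fun q => ?_⟩
    have hA' := hrA _ (hcode p hp)
    have he : pat (r (code p)) = pat p := by
      have := hr _ (hcode p hp)
      simp only [code, Sigma.mk.injEq] at this
      exact eq_of_heq this.2
    rw [abs_le]
    have h1 := hclose p hp _ hA' he.symm q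
    have h2 := hclose _ hA' p hp he q
    constructor <;> linarith

/-! ### Massart's finite class lemma -/

/-- The exponential moment of a Rademacher sum. -/
theorem sum_signs_exp_le {n : ℕ} (x : Fin n → ℝ) :
    ∑ ω : Fin n → ℤˣ, Real.exp (∑ j, (((ω j : ℤˣ) : ℤ) : ℝ) * x j) ≤
      2 ^ n * Real.exp ((∑ j, x j ^ 2) / 2) := by
  have h1 : ∑ ω : Fin n → ℤˣ, Real.exp (∑ j, (((ω j : ℤˣ) : ℤ) : ℝ) * x j) =
      ∏ j, ∑ s : ℤˣ, Real.exp (((s : ℤ) : ℝ) * x j) := by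
    rw [Finset.prod_univ_sum, Fintype.piFinset_univ]
    exact Finset.sum_congr rfl fun ω _ => Real.exp_sum _ _
  have h2 : ∀ y : ℝ, ∑ s : ℤˣ, Real.exp (((s : ℤ) : ℝ) * y) ≤ 2 * Real.exp (y ^ 2 / 2) := by
    intro y
    have := Real.cosh_le_exp_half_sq y
    rw [Real.cosh_eq] at this
    have hu : (Finset.univ : Finset ℤˣ) = {1, -1} := rfl
    rw [hu, Finset.sum_pair (by decide)]
    simp
    linarith
  rw [h1, Finset.sum_div, Real.exp_sum]
  calc _ ≤ ∏ j, (2 * Real.exp (x j ^ 2 / 2)) := Finset.prod_le_prod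
        (fun j _ => Finset.sum_nonneg fun s _ => (Real.exp_pos _).le) fun j _ => h2 (x j)
    _ = _ := by rw [Finset.prod_mul_distrib]; simp

/-- **Massart's lemma**. -/
theorem average_signs_le {n : ℕ} (hn : 1 ≤ n) (T : Finset (Fin n → ℝ)) (B : ℝ) (hB : 0 < B)
    (hT : ∀ x ∈ T, ∀ j, |x j| ≤ B) (K : ℝ) (hK : 1 < K) (hTK : (T.card : ℝ) ≤ K)
    (m : (Fin n → ℤˣ) → ℝ)
    (hm : ∀ ω, ∃ x ∈ T, m ω ≤ ∑ j, (((ω j : ℤˣ) : ℤ) : ℝ) * x j) :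
    (1 / (2 : ℝ) ^ n) * ∑ ω, m ω ≤ B * √(2 * n * Real.log K) := by
  have hlog : 0 < Real.log K := Real.log_pos hK
  have hn' : (0 : ℝ) < n := by exact_mod_cast hn
  set s := √(2 * n * Real.log K) with hs
  have hs2 : s ^ 2 = 2 * n * Real.log K := Real.sq_sqrt (by positivity)
  have hspos : 0 < s := Real.sqrt_pos.2 (by positivity)
  -- The minimizer of `log K / l + l * n * B ^ 2 / 2`, the bound produced by exponential moments.
  set l := s / (n * B) with hl
  have hlpos : 0 < l := by positivity
  set c := Real.log K + l ^ 2 * (n * B ^ 2) / 2 with hc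
  have hexp : ∑ ω : Fin n → ℤˣ, Real.exp (l * m ω) ≤ 2 ^ n * Real.exp c := by
    calc ∑ ω : Fin n → ℤˣ, Real.exp (l * m ω)
        ≤ ∑ ω : Fin n → ℤˣ, ∑ x ∈ T,
            Real.exp (∑ j, (((ω j : ℤˣ) : ℤ) : ℝ) * (l * x j)) := by
          refine Finset.sum_le_sum fun ω _ => ?_
          obtain ⟨x, hx, hle⟩ := hm ω
          refine le_trans ?_ (Finset.single_le_sum
            (f := fun x => Real.exp (∑ j, (((ω j : ℤˣ) : ℤ) : ℝ) * (l * x j)))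
            (fun _ _ => (Real.exp_pos _).le) hx)
          apply Real.exp_le_exp.2
          calc l * m ω ≤ l * ∑ j, (((ω j : ℤˣ) : ℤ) : ℝ) * x j := by gcongr
            _ = _ := by rw [Finset.mul_sum]; exact Finset.sum_congr rfl fun j _ => by ring
      _ ≤ ∑ x ∈ T, 2 ^ n * Real.exp (l ^ 2 * (n * B ^ 2) / 2) := by
          rw [Finset.sum_comm]
          refine Finset.sum_le_sum fun x hx => (sum_signs_exp_le _).trans ?_
          gcongr
          calc ∑ j, (l * x j) ^ 2 ≤ ∑ _j : Fin n, l ^ 2 * B ^ 2 := by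
                refine Finset.sum_le_sum fun j _ => ?_
                rw [mul_pow]
                exact mul_le_mul_of_nonneg_left
                  (sq_le_sq' (abs_le.1 (hT x hx j)).1 (abs_le.1 (hT x hx j)).2) (sq_nonneg _)
            _ = _ := by simp; ring
      _ ≤ _ := by
          rw [Finset.sum_const, nsmul_eq_mul, hc, Real.exp_add, Real.exp_log (by linarith)]
          calc _ ≤ K * (2 ^ n * Real.exp (l ^ 2 * (n * B ^ 2) / 2)) := by gcongr
            _ = _ := by ring
  have hlin : ∑ ω, l * m ω ≤ 2 ^ n * c := by
    -- The tangent line of `exp` at `c` plays the role of Jensen's inequality.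
    have h1 : ∀ ω, l * m ω ≤ c - 1 + Real.exp (l * m ω) * Real.exp (-c) := fun ω => by
      rw [← Real.exp_add]
      have := Real.add_one_le_exp (l * m ω + -c)
      linarith
    calc ∑ ω, l * m ω ≤ ∑ ω, (c - 1 + Real.exp (l * m ω) * Real.exp (-c)) :=
          Finset.sum_le_sum fun ω _ => h1 ω
      _ = 2 ^ n * (c - 1) + (∑ ω : Fin n → ℤˣ, Real.exp (l * m ω)) * Real.exp (-c) := by
          rw [Finset.sum_add_distrib, ← Finset.sum_mul]
          simp [Fintype.card_units_int]
          ring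
      _ ≤ 2 ^ n * (c - 1) + (2 ^ n * Real.exp c) * Real.exp (-c) := by gcongr
      _ = 2 ^ n * c := by
          rw [mul_assoc, ← Real.exp_add]; simp; ring
  rw [← Finset.mul_sum] at hlin
  have hcl : c = l * (B * s) := by
    rw [hc, hl]
    have : Real.log K = s ^ 2 / (2 * n) := by rw [hs2]; field_simp
    rw [this]
    field_simp
    ring
  rw [hcl] at hlin
  have : ∑ ω, m ω ≤ 2 ^ n * (B * s) := by
    have h3 : l * ∑ ω, m ω ≤ l * (2 ^ n * (B * s)) := by linarith
    exact le_of_mul_le_mul_left h3 hlpos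
  rw [one_div, inv_mul_le_iff₀ (by positivity)]
  exact this

/-! ### Rademacher averages of a parametrized class -/

/-- Turns the supremum over an uncountable parameter set into a countable one, which makes it
measurable in the sample. -/
theorem ciSup_denseSeq {Y : Type*} [TopologicalSpace Y] [TopologicalSpace.SeparableSpace Y]
    [Nonempty Y] {f : Y → ℝ} (hf : Continuous f) (hb : BddAbove (Set.range f)) :
    ⨆ y, f y = ⨆ k, f (TopologicalSpace.denseSeq Y k) := by
  have hb' : BddAbove (Set.range fun k => f (TopologicalSpace.denseSeq Y k)) :=
    hb.mono (by rintro _ ⟨k, rfl⟩; exact ⟨_, rfl⟩)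
  refine le_antisymm (ciSup_le fun y => ?_) (ciSup_le fun k => le_ciSup hb _)
  have hcl : IsClosed {y | f y ≤ ⨆ k, f (TopologicalSpace.denseSeq Y k)} :=
    isClosed_le hf continuous_const
  have := (TopologicalSpace.denseRange_denseSeq Y).closure_range
  have hsub : closure (Set.range (TopologicalSpace.denseSeq Y)) ⊆
      {y | f y ≤ ⨆ k, f (TopologicalSpace.denseSeq Y k)} :=
    closure_minimal (by rintro _ ⟨k, rfl⟩; exact le_ciSup hb' k) hcl
  exact hsub (this ▸ Set.mem_univ y)

section Rademacher

variable {X V : Type*} {n : ℕ} {Θ : Set V} {v : V → X → ℝ} {B : ℝ}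

theorem sSup_rademacherSums_image (ω : Fin n → ℤˣ) (ξ : Fin n → X) :
    sSup (rademacherSums (v '' Θ) ω ξ) =
      ⨆ p : Θ, (1 / (n : ℝ)) * ∑ j, (((ω j : ℤˣ) : ℤ) : ℝ) * v p (ξ j) := by
  rw [rademacherSums, Set.image_image, sSup_image']

theorem abs_sign_sum_le (hn : 1 ≤ n) (ω : Fin n → ℤˣ) {x : Fin n → ℝ} (hx : ∀ j, |x j| ≤ B) :
    |(1 / (n : ℝ)) * ∑ j, (((ω j : ℤˣ) : ℤ) : ℝ) * x j| ≤ B := by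
  have hn' : (0 : ℝ) < n := by exact_mod_cast hn
  rw [abs_mul, abs_of_pos (by positivity), one_div, inv_mul_le_iff₀ hn']
  calc _ ≤ ∑ j, |(((ω j : ℤˣ) : ℤ) : ℝ) * x j| := Finset.abs_sum_le_sum_abs _ _
    _ ≤ ∑ _j : Fin n, B := Finset.sum_le_sum fun j _ => by
        have h1 : |(((ω j : ℤˣ) : ℤ) : ℝ)| = 1 := by
          rcases Int.units_eq_one_or (ω j) with h | h <;> simp [h]
        rw [abs_mul, h1, one_mul]
        exact hx j
    _ = _ := by simp

theorem bddAbove_sign_sums (hn : 1 ≤ n) (ω : Fin n → ℤˣ) {ξ : Fin n → X}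
    (hξ : ∀ j, ∀ p ∈ Θ, |v p (ξ j)| ≤ B) :
    BddAbove (Set.range fun p : Θ =>
      (1 / (n : ℝ)) * ∑ j, (((ω j : ℤˣ) : ℤ) : ℝ) * v p (ξ j)) := by
  refine ⟨B, ?_⟩
  rintro _ ⟨p, rfl⟩
  exact (le_abs_self _).trans (abs_sign_sum_le hn ω fun j => hξ j p p.2)

/-- Replacing a parameter by its neighbour in the net costs at most `η` in the normalized sum;
Massart's lemma handles the net. The sample is fixed here. -/
theorem average_sSup_le (hn : 1 ≤ n) (hΘ : Θ.Nonempty) (hB : 0 < B) {ξ : Fin n → X}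
    (hξ : ∀ j, ∀ p ∈ Θ, |v p (ξ j)| ≤ B) {η K : ℝ} (hK : 1 < K) (T : Finset V)
    (hT : (T : Set V) ⊆ Θ) (hTK : (T.card : ℝ) ≤ K)
    (hcov : ∀ p ∈ Θ, ∃ p' ∈ T, ∀ j, |v p (ξ j) - v p' (ξ j)| ≤ η) :
    (1 / (2 : ℝ) ^ n) * ∑ ω : Fin n → ℤˣ, sSup (rademacherSums (v '' Θ) ω ξ) ≤
      η + B * √(2 * n * Real.log K) / n := by
  classical
  have hne : Nonempty Θ := hΘ.to_subtype
  have hn' : (0 : ℝ) < n := by exact_mod_cast hn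
  have hTne : T.Nonempty := by
    obtain ⟨p, hp⟩ := hΘ
    obtain ⟨p', hp', -⟩ := hcov p hp
    exact ⟨p', hp'⟩
  have key := average_signs_le hn (T.image fun p j => v p (ξ j)) B hB
    (by
      intro x hx j
      obtain ⟨p, hp, rfl⟩ := Finset.mem_image.1 hx
      exact hξ j p (hT hp)) K hK
    (le_trans (by exact_mod_cast Finset.card_image_le) hTK)
    -- The supremum lowered by `η` and rescaled is dominated by the best element of the net for the
    -- signs `ω`.
    (fun ω => n * (sSup (rademacherSums (v '' Θ) ω ξ) - η))
    (by
      intro ω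
      obtain ⟨p₀, hp₀, hmax⟩ := T.exists_max_image
        (fun p => ∑ j, (((ω j : ℤˣ) : ℤ) : ℝ) * v p (ξ j)) hTne
      refine ⟨_, Finset.mem_image_of_mem _ hp₀, ?_⟩
      rw [← le_div_iff₀' hn', sub_le_iff_le_add, sSup_rademacherSums_image]
      refine ciSup_le fun p => ?_
      obtain ⟨p', hp', hclose⟩ := hcov p p.2
      have h1 := (abs_le.1 (abs_sign_sum_le hn ω hclose)).2
      have h2 := hmax p' hp'
      have h3 : (1 / (n : ℝ)) * ∑ j, (((ω j : ℤˣ) : ℤ) : ℝ) * v p' (ξ j) ≤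
          (∑ j, (((ω j : ℤˣ) : ℤ) : ℝ) * v p₀ (ξ j)) / n := by
        rw [one_div, inv_mul_eq_div]
        gcongr
      simp only [mul_sub, Finset.sum_sub_distrib] at h1
      linarith)
  have hsum : (1 / (2 : ℝ) ^ n) *
      ∑ ω : Fin n → ℤˣ, (n : ℝ) * (sSup (rademacherSums (v '' Θ) ω ξ) - η) =
      n * ((1 / (2 : ℝ) ^ n) * ∑ ω : Fin n → ℤˣ, sSup (rademacherSums (v '' Θ) ω ξ) - η) := by
    rw [← Finset.mul_sum, Finset.sum_sub_distrib]
    simp only [Finset.sum_const, Finset.card_univ, Fintype.card_fun, Fintype.card_units_int,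
      Fintype.card_fin, nsmul_eq_mul, Nat.cast_pow, Nat.cast_ofNat]
    field_simp
  rw [hsum, ← le_div_iff₀' hn'] at key
  linarith

variable [MeasurableSpace X] {μ : Measure X}

/-- Conditioning on a set of measure zero or infinity yields the zero measure; this covers those
degenerate cases. -/
theorem rademacherWellDefined_zero (hn : 1 ≤ n) (F : Set (X → ℝ)) :
    RademacherWellDefined (0 : Measure X) n F ∧ rademacherComplexity (0 : Measure X) n F = 0 := by
  have h0 : Measure.pi (fun _ : Fin n => (0 : Measure X)) = 0 := by
    rw [← Measure.measure_univ_eq_zero, Measure.pi_univ]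
    exact Finset.prod_eq_zero (Finset.mem_univ ⟨0, hn⟩) (by simp)
  constructor
  · intro ω
    rw [h0]
    exact ⟨by simp, integrable_zero_measure⟩
  · rw [rademacherComplexity, h0, integral_zero_measure]

theorem ae_forall_sample [SigmaFinite μ] {p : X → Prop} (h : ∀ᵐ x ∂μ, p x) :
    ∀ᵐ ξ ∂(Measure.pi fun _ : Fin n => μ), ∀ j, p (ξ j) :=
  ae_all_iff.2 fun j => (Measure.quasiMeasurePreserving_eval (fun _ : Fin n => μ) j).ae h

theorem rademacherWellDefined_image [IsProbabilityMeasure μ] [TopologicalSpace V]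
    [SecondCountableTopology V] (hn : 1 ≤ n) (hΘ : Θ.Nonempty)
    (hc : ∀ x, Continuous fun p => v p x) (hm : ∀ p ∈ Θ, AEMeasurable (v p) μ)
    (hB : ∀ᵐ x ∂μ, ∀ p ∈ Θ, |v p x| ≤ B) : RademacherWellDefined μ n (v '' Θ) := by
  intro ω
  have hne : Nonempty Θ := hΘ.to_subtype
  have hae := ae_forall_sample (n := n) hB
  constructor
  · filter_upwards [hae] with ξ hξ
    rw [rademacherSums, Set.image_image, Set.image_eq_range]
    exact bddAbove_sign_sums hn ω hξ
  · simp_rw [sSup_rademacherSums_image]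
    refine Integrable.of_bound (C := B) ?_ ?_
    · have h1 : AEMeasurable (fun ξ : Fin n → X => ⨆ k, (1 / (n : ℝ)) * ∑ j,
          (((ω j : ℤˣ) : ℤ) : ℝ) * v (TopologicalSpace.denseSeq Θ k : Θ) (ξ j))
          (Measure.pi fun _ : Fin n => μ) := by
        refine AEMeasurable.iSup fun k => AEMeasurable.const_mul ?_ _
        refine Finset.aemeasurable_fun_sum _ fun j _ => AEMeasurable.const_mul ?_ _
        exact (hm _ (Subtype.prop _)).comp_quasiMeasurePreserving
          (Measure.quasiMeasurePreserving_eval (fun _ : Fin n => μ) j)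
      refine (h1.congr ?_).aestronglyMeasurable
      filter_upwards [hae] with ξ hξ
      refine (ciSup_denseSeq ?_ (bddAbove_sign_sums hn ω hξ)).symm
      refine continuous_const.mul (continuous_finsetSum _ fun j _ => continuous_const.mul ?_)
      exact (hc (ξ j)).comp continuous_subtype_val
    · filter_upwards [hae] with ξ hξ
      rw [Real.norm_eq_abs, abs_le]
      have hb := bddAbove_sign_sums hn ω hξ
      constructor
      · obtain ⟨p⟩ := hne
        exact (abs_le.1 (abs_sign_sum_le hn ω fun j => hξ j p p.2)).1.trans (le_ciSup hb p)
      · exact ciSup_le fun p => (abs_le.1 (abs_sign_sum_le hn ω fun j => hξ j p p.2)).2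

theorem rademacherComplexity_le_of_ae [IsProbabilityMeasure μ] {F : Set (X → ℝ)}
    (hF : RademacherWellDefined μ n F) {b : ℝ}
    (hb : ∀ᵐ ξ ∂(Measure.pi fun _ : Fin n => μ),
      (1 / (2 : ℝ) ^ n) * ∑ ω : Fin n → ℤˣ, sSup (rademacherSums F ω ξ) ≤ b) :
    rademacherComplexity μ n F ≤ b := by
  have hint : Integrable (fun ξ : Fin n → X =>
      (1 / (2 : ℝ) ^ n) * ∑ ω : Fin n → ℤˣ, sSup (rademacherSums F ω ξ))
      (Measure.pi fun _ : Fin n => μ) :=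
    (integrable_finsetSum _ fun ω _ => (hF ω).2).const_mul _
  calc rademacherComplexity μ n F ≤ ∫ _ξ : Fin n → X, b ∂(Measure.pi fun _ : Fin n => μ) :=
        integral_mono_ae hint (integrable_const _) hb
    _ = b := by simp

/-- The net may depend on the sample; only its cardinality bound has to be uniform. This is what
permits nets built from the first-layer values at the sample points. -/
theorem rademacherComplexity_image_le [IsProbabilityMeasure μ] (hn : 1 ≤ n) (hΘ : Θ.Nonempty)
    (hF : RademacherWellDefined μ n (v '' Θ)) (hB0 : 0 < B)
    (hB : ∀ᵐ x ∂μ, ∀ p ∈ Θ, |v p x| ≤ B) {η K : ℝ} (hK : 1 < K)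
    (hcov : ∀ ξ : Fin n → X, (∀ j, ∀ p ∈ Θ, |v p (ξ j)| ≤ B) → ∃ T : Finset V, (T : Set V) ⊆ Θ ∧
      (T.card : ℝ) ≤ K ∧ ∀ p ∈ Θ, ∃ p' ∈ T, ∀ j, |v p (ξ j) - v p' (ξ j)| ≤ η) :
    rademacherComplexity μ n (v '' Θ) ≤ η + B * √(2 * n * Real.log K) / n := by
  refine rademacherComplexity_le_of_ae hF ?_
  filter_upwards [ae_forall_sample hB] with ξ hξ
  obtain ⟨T, hT, hTK, hc⟩ := hcov ξ hξ
  exact average_sSup_le hn hΘ hB0 hξ hK T hT hTK hc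

theorem rademacherComplexity_singleton [IsProbabilityMeasure μ] {f : X → ℝ}
    (hF : RademacherWellDefined μ n {f}) : rademacherComplexity μ n {f} ≤ 0 := by
  refine rademacherComplexity_le_of_ae hF (Filter.Eventually.of_forall fun ξ => le_of_eq ?_)
  have h1 : ∀ ω : Fin n → ℤˣ, sSup (rademacherSums {f} ω ξ) =
      (1 / (n : ℝ)) * ∑ j, (((ω j : ℤˣ) : ℤ) : ℝ) * f (ξ j) := fun ω => by
    simp [rademacherSums]
  -- The substitution `ω ↦ -ω` shows that the sum is its own negative.
  have h2 : ∑ ω : Fin n → ℤˣ, (1 / (n : ℝ)) * ∑ j, (((ω j : ℤˣ) : ℤ) : ℝ) * f (ξ j) =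
      -∑ ω : Fin n → ℤˣ, (1 / (n : ℝ)) * ∑ j, (((ω j : ℤˣ) : ℤ) : ℝ) * f (ξ j) := by
    conv_lhs => rw [← Equiv.sum_comp (Equiv.neg (Fin n → ℤˣ))]
    simp [Finset.sum_neg_distrib]
  simp_rw [h1]
  rw [self_eq_neg.1 h2, mul_zero]

end Rademacher

/-! ### The two activation functions -/

/-- A bounded monotone activation function `ρ` with first two derivatives `ρ₁`, `ρ₂`, which are
bounded and Lipschitz functions of the value of `ρ`. -/
structure IsSigmoidal (ρ ρ₁ ρ₂ : ℝ → ℝ) : Prop where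
  mono : Monotone ρ
  abs_le : ∀ z, |ρ z| ≤ 1
  abs_le₁ : ∀ z, |ρ₁ z| ≤ 1
  abs_le₂ : ∀ z, |ρ₂ z| ≤ 2
  hasDerivAt : ∀ z, HasDerivAt ρ (ρ₁ z) z
  hasDerivAt₁ : ∀ z, HasDerivAt ρ₁ (ρ₂ z) z
  lip₁ : ∀ y z, |ρ₁ y - ρ₁ z| ≤ 2 * |ρ y - ρ z|
  lip₂ : ∀ y z, |ρ₂ y - ρ₂ z| ≤ 8 * |ρ y - ρ z|
  continuous₂ : Continuous ρ₂

theorem isSigmoidal_tanh : IsSigmoidal Real.tanh (fun z => 1 - Real.tanh z ^ 2)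
    (fun z => -2 * Real.tanh z * (1 - Real.tanh z ^ 2)) := by
  have hd : ∀ z, HasDerivAt Real.tanh (1 - Real.tanh z ^ 2) z := fun z => by
    have hc := (Real.cosh_pos z).ne'
    have := (Real.hasDerivAt_sinh z).div (Real.hasDerivAt_cosh z) hc
    have he : Real.tanh = fun z => Real.sinh z / Real.cosh z := funext Real.tanh_eq_sinh_div_cosh
    rw [he]
    convert! this using 1
    field_simp
  have hb : ∀ z, -1 ≤ Real.tanh z ∧ Real.tanh z ≤ 1 := fun z =>
    ⟨(Real.neg_one_lt_tanh z).le, (Real.tanh_lt_one z).le⟩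
  have hcont : Continuous Real.tanh := continuous_iff_continuousAt.2 fun z => (hd z).continuousAt
  have hsq : ∀ z, 0 ≤ 1 - Real.tanh z ^ 2 ∧ 1 - Real.tanh z ^ 2 ≤ 1 := fun z => by
    have := hb z
    constructor <;> nlinarith
  refine ⟨?_, fun z => abs_le.2 (hb z), fun z => ?_, fun z => ?_, hd, fun z => ?_, fun y z => ?_,
    fun y z => ?_, by fun_prop⟩
  · refine monotone_of_deriv_nonneg (fun z => (hd z).differentiableAt) fun z => ?_
    rw [(hd z).deriv]
    exact (hsq z).1
  · rw [abs_of_nonneg (hsq z).1]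
    exact (hsq z).2
  · rw [abs_mul, abs_mul, abs_of_nonneg (hsq z).1]
    have := abs_le.2 (hb z)
    norm_num
    nlinarith [hsq z, abs_nonneg (Real.tanh z)]
  · convert! ((hd z).pow 2).const_sub 1 using 1
    simp
  · have : (1 - Real.tanh y ^ 2) - (1 - Real.tanh z ^ 2) =
        -(Real.tanh y + Real.tanh z) * (Real.tanh y - Real.tanh z) := by ring
    rw [this, abs_mul]
    gcongr
    rw [abs_le]
    constructor <;> linarith [hb y, hb z]
  -- The second derivative is a cubic polynomial in `tanh`, so its increment factors through the
  -- increment of `tanh`, with a quotient bounded on `[-1, 1]`.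
  · have : -2 * Real.tanh y * (1 - Real.tanh y ^ 2) - -2 * Real.tanh z * (1 - Real.tanh z ^ 2) =
        (2 * (Real.tanh y ^ 2 + Real.tanh y * Real.tanh z + Real.tanh z ^ 2) - 2) *
          (Real.tanh y - Real.tanh z) := by ring
    rw [this, abs_mul]
    gcongr
    obtain ⟨a1, a2⟩ := hb y
    obtain ⟨b1, b2⟩ := hb z
    rw [abs_le]
    constructor <;> nlinarith [hsq y, hsq z, sq_nonneg (Real.tanh y + Real.tanh z),
      sq_nonneg (Real.tanh y - Real.tanh z)]

theorem isSigmoidal_sigmoid : IsSigmoidal Real.sigmoid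
    (fun z => Real.sigmoid z * (1 - Real.sigmoid z))
    (fun z => Real.sigmoid z * (1 - Real.sigmoid z) * (1 - 2 * Real.sigmoid z)) := by
  have hd := Real.hasDerivAt_sigmoid
  have hb : ∀ z, 0 ≤ Real.sigmoid z ∧ Real.sigmoid z ≤ 1 := fun z =>
    ⟨Real.sigmoid_nonneg z, Real.sigmoid_le_one z⟩
  have hcont : Continuous Real.sigmoid :=
    continuous_iff_continuousAt.2 fun z => (hd z).continuousAt
  have hsq : ∀ z, 0 ≤ Real.sigmoid z * (1 - Real.sigmoid z) ∧
      Real.sigmoid z * (1 - Real.sigmoid z) ≤ 1 := fun z => by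
    have := hb z
    constructor <;> nlinarith
  refine ⟨Real.sigmoid_monotone, fun z => abs_le.2 ⟨by linarith [hb z], (hb z).2⟩, fun z => ?_,
    fun z => ?_, hd, fun z => ?_, fun y z => ?_, fun y z => ?_, by fun_prop⟩
  · rw [abs_of_nonneg (hsq z).1]
    exact (hsq z).2
  · rw [abs_mul, abs_of_nonneg (hsq z).1]
    have : |1 - 2 * Real.sigmoid z| ≤ 2 := abs_le.2 ⟨by linarith [hb z], by linarith [hb z]⟩
    nlinarith [hsq z, abs_nonneg (1 - 2 * Real.sigmoid z)]
  · convert! (hd z).mul ((hd z).const_sub 1) using 1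
    ring
  · have : Real.sigmoid y * (1 - Real.sigmoid y) - Real.sigmoid z * (1 - Real.sigmoid z) =
        (1 - Real.sigmoid y - Real.sigmoid z) * (Real.sigmoid y - Real.sigmoid z) := by ring
    rw [this, abs_mul]
    gcongr
    rw [abs_le]
    constructor <;> linarith [hb y, hb z]
  · have : Real.sigmoid y * (1 - Real.sigmoid y) * (1 - 2 * Real.sigmoid y) -
        Real.sigmoid z * (1 - Real.sigmoid z) * (1 - 2 * Real.sigmoid z) =
        (1 - 3 * (Real.sigmoid y + Real.sigmoid z) + 2 * (Real.sigmoid y ^ 2 +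
          Real.sigmoid y * Real.sigmoid z + Real.sigmoid z ^ 2)) *
          (Real.sigmoid y - Real.sigmoid z) := by ring
    rw [this, abs_mul]
    gcongr
    obtain ⟨a1, a2⟩ := hb y
    obtain ⟨b1, b2⟩ := hb z
    rw [abs_le]
    constructor <;> nlinarith [mul_nonneg a1 b1]

/-! ### Networks acting on second-order jets -/

section Jets

/-- A value together with a first and a second derivative in a fixed direction. -/
abbrev Jet := ℝ × ℝ × ℝ

/-- An affine function applied to jets; the index `none` belongs to the bias. -/
def jetAff {k : ℕ} (w : Option (Fin k) → ℝ) (h : Fin k → Jet) : Jet :=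
  (∑ c, w (some c) * (h c).1 + w none, ∑ c, w (some c) * (h c).2.1, ∑ c, w (some c) * (h c).2.2)

/-- The activation function applied to a jet. -/
def jetAct (ρ ρ₁ ρ₂ : ℝ → ℝ) (j : Jet) : Jet :=
  (ρ j.1, ρ₁ j.1 * j.2.1, ρ₂ j.1 * j.2.1 ^ 2 + ρ₁ j.1 * j.2.2)

/-- `M` hidden layers of width `N`, applied to jets. -/
def jetRun (ρ ρ₁ ρ₂ : ℝ → ℝ) {N : ℕ} : (M : ℕ) → (Fin M → Fin N → Option (Fin N) → ℝ) →
    (Fin N → Jet) → Fin N → Jet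
  | 0, _, h => h
  | M + 1, w, h => jetRun ρ ρ₁ ρ₂ M (fun l => w l.succ)
      fun t => jetAct ρ ρ₁ ρ₂ (jetAff (w 0 t) h)

/-- The positions of the parameters of a network `ℝᵈ → ℝ` with `M + 1` hidden layers of width
`N`. -/
abbrev ParamIdx (d N M : ℕ) :=
  (Fin N × Option (Fin d)) ⊕ ((Fin M × Fin N × Option (Fin N)) ⊕ Option (Fin N))

/-- The jet of the point `x` in the `k`-th coordinate direction. -/
def inputJet {d : ℕ} (x : Fin d → ℝ) (k c : Fin d) : Jet := (x c, if c = k then 1 else 0, 0)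

/-- The jets of the first hidden layer. -/
def firstJet (ρ ρ₁ ρ₂ : ℝ → ℝ) {d N M : ℕ} (p : ParamIdx d N M → ℝ) (x : Fin d → ℝ) (k : Fin d)
    (t : Fin N) : Jet :=
  jetAct ρ ρ₁ ρ₂ (jetAff (fun o => p (.inl (t, o))) (inputJet x k))

/-- The network with parameters `p`: value at `x`, and the first two derivatives in the `k`-th
coordinate direction. -/
def netJet (ρ ρ₁ ρ₂ : ℝ → ℝ) {d N M : ℕ} (p : ParamIdx d N M → ℝ) (x : Fin d → ℝ) (k : Fin d) :
    Jet :=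
  jetAff (fun o => p (.inr (.inr o))) (jetRun ρ ρ₁ ρ₂ M (fun l t o => p (.inr (.inl (l, t, o))))
    (firstJet ρ ρ₁ ρ₂ p x k))

variable {ρ ρ₁ ρ₂ : ℝ → ℝ} {d N M : ℕ}

theorem jetRun_fst_congr : ∀ (M : ℕ) (w : Fin M → Fin N → Option (Fin N) → ℝ)
    (h h' : Fin N → Jet), (∀ t, (h t).1 = (h' t).1) →
    ∀ t, (jetRun ρ ρ₁ ρ₂ M w h t).1 = (jetRun ρ ρ₁ ρ₂ M w h' t).1
  | 0, _, _, _, hh => hh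
  | M + 1, w, h, h', hh => jetRun_fst_congr M _ _ _ fun t => by simp [jetAct, jetAff, hh]

/-- The direction only enters the derivative components. Hence one function has all the jets, for
varying `k`, that its Laplacian requires. -/
theorem netJet_fst_eq (p : ParamIdx d N M → ℝ) (x : Fin d → ℝ) (k k' : Fin d) :
    (netJet ρ ρ₁ ρ₂ p x k).1 = (netJet ρ ρ₁ ρ₂ p x k').1 := by
  have := jetRun_fst_congr (ρ := ρ) (ρ₁ := ρ₁) (ρ₂ := ρ₂) M
    (fun l t o => p (.inr (.inl (l, t, o)))) (firstJet ρ ρ₁ ρ₂ p x k) (firstJet ρ ρ₁ ρ₂ p x k')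
    (fun t => by simp [firstJet, jetAct, jetAff, inputJet])
  simp [netJet, jetAff, this]

/-! ### Regularity -/

theorem IsSigmoidal.continuous (H : IsSigmoidal ρ ρ₁ ρ₂) : Continuous ρ :=
  continuous_iff_continuousAt.2 fun z => (H.hasDerivAt z).continuousAt

theorem IsSigmoidal.continuous₁ (H : IsSigmoidal ρ ρ₁ ρ₂) : Continuous ρ₁ :=
  continuous_iff_continuousAt.2 fun z => (H.hasDerivAt₁ z).continuousAt

theorem IsSigmoidal.contDiff (H : IsSigmoidal ρ ρ₁ ρ₂) : ContDiff ℝ 2 ρ := by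
  have h1 : deriv ρ = ρ₁ := funext fun z => (H.hasDerivAt z).deriv
  have h2 : deriv ρ₁ = ρ₂ := funext fun z => (H.hasDerivAt₁ z).deriv
  rw [show (2 : WithTop ℕ∞) = 1 + 1 by norm_num, contDiff_succ_iff_deriv]
  refine ⟨fun z => (H.hasDerivAt z).differentiableAt, by simp, ?_⟩
  rw [h1, contDiff_one_iff_deriv, h2]
  exact ⟨fun z => (H.hasDerivAt₁ z).differentiableAt, H.continuous₂⟩

theorem continuous_jetAff {Y : Type*} [TopologicalSpace Y] {k : ℕ} {w : Y → Option (Fin k) → ℝ}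
    {h : Y → Fin k → Jet} (hw : ∀ o, Continuous fun y => w y o)
    (hh : ∀ c, Continuous fun y => h y c) : Continuous fun y => jetAff (w y) (h y) := by
  unfold jetAff
  fun_prop

theorem IsSigmoidal.continuous_jetAct (H : IsSigmoidal ρ ρ₁ ρ₂) :
    Continuous (jetAct ρ ρ₁ ρ₂) := by
  have h0 := H.continuous
  have h1 := H.continuous₁
  have h2 := H.continuous₂
  unfold jetAct
  fun_prop

theorem IsSigmoidal.continuous_jetRun (H : IsSigmoidal ρ ρ₁ ρ₂) {Y : Type*} [TopologicalSpace Y] :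
    ∀ (M : ℕ) {w : Y → Fin M → Fin N → Option (Fin N) → ℝ} {h : Y → Fin N → Jet},
    (∀ l t o, Continuous fun y => w y l t o) → (∀ t, Continuous fun y => h y t) →
    ∀ t, Continuous fun y => jetRun ρ ρ₁ ρ₂ M (w y) (h y) t
  | 0, _, _, _, hh => hh
  | M + 1, _, _, hw, hh => H.continuous_jetRun M (fun l => hw l.succ) fun t =>
      H.continuous_jetAct.comp (continuous_jetAff (hw 0 t) hh)

theorem IsSigmoidal.continuous_netJet (H : IsSigmoidal ρ ρ₁ ρ₂) (k : Fin d) :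
    Continuous fun y : (ParamIdx d N M → ℝ) × (Fin d → ℝ) => netJet ρ ρ₁ ρ₂ y.1 y.2 k := by
  refine continuous_jetAff (fun o => by fun_prop) (H.continuous_jetRun M (fun l t o => by fun_prop)
    fun t => H.continuous_jetAct.comp (continuous_jetAff (fun o => by fun_prop) fun c => ?_))
  unfold inputJet
  fun_prop

theorem IsSigmoidal.contDiff_jetRun (H : IsSigmoidal ρ ρ₁ ρ₂) {E : Type*} [NormedAddCommGroup E]
    [NormedSpace ℝ E] : ∀ (M : ℕ) (w : Fin M → Fin N → Option (Fin N) → ℝ) {h : E → Fin N → Jet},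
    (∀ t, ContDiff ℝ 2 fun y => (h y t).1) →
    ∀ t, ContDiff ℝ 2 fun y => (jetRun ρ ρ₁ ρ₂ M w (h y) t).1
  | 0, _, _, hh => hh
  | M + 1, w, h, hh => H.contDiff_jetRun M _ fun t => H.contDiff.comp
      (f := fun y => (jetAff (w 0 t) (h y)).1) (by unfold jetAff; fun_prop)

theorem IsSigmoidal.contDiff_netJet (H : IsSigmoidal ρ ρ₁ ρ₂) (p : ParamIdx d N M → ℝ)
    (k : Fin d) : ContDiff ℝ 2 fun x : EuclideanSpace ℝ (Fin d) =>
      (netJet ρ ρ₁ ρ₂ p (fun i => x i) k).1 := by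
  have h1 : ∀ t, ContDiff ℝ 2 fun x : EuclideanSpace ℝ (Fin d) =>
      (firstJet ρ ρ₁ ρ₂ p (fun i => x i) k t).1 := fun t => H.contDiff.comp
    (f := fun x : EuclideanSpace ℝ (Fin d) =>
      (jetAff (fun o => p (.inl (t, o))) (inputJet (fun i => x i) k)).1)
    (by unfold jetAff inputJet; fun_prop)
  have h2 := H.contDiff_jetRun M (fun l t o => p (.inr (.inl (l, t, o)))) h1
  unfold netJet jetAff
  fun_prop

/-! ### Derivatives along lines -/

/-- `h` is the jet of a function of one real variable. -/
def IsJetOf (h : ℝ → Jet) : Prop :=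
  ∀ t, HasDerivAt (fun s => (h s).1) (h t).2.1 t ∧ HasDerivAt (fun s => (h s).2.1) (h t).2.2 t

theorem isJetOf_jetAff {k : ℕ} (w : Option (Fin k) → ℝ) {h : ℝ → Fin k → Jet}
    (hh : ∀ c, IsJetOf fun s => h s c) : IsJetOf fun s => jetAff w (h s) := fun t =>
  ⟨(HasDerivAt.fun_sum (u := Finset.univ) fun c _ =>
      ((hh c t).1.const_mul (w (some c)))).add_const _,
    HasDerivAt.fun_sum (u := Finset.univ) fun c _ => ((hh c t).2.const_mul (w (some c)))⟩

theorem IsSigmoidal.isJetOf_jetAct (H : IsSigmoidal ρ ρ₁ ρ₂) {h : ℝ → Jet} (hh : IsJetOf h) :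
    IsJetOf fun s => jetAct ρ ρ₁ ρ₂ (h s) := fun t => by
  obtain ⟨h1, h2⟩ := hh t
  refine ⟨(H.hasDerivAt (h t).1).comp t h1, ?_⟩
  convert! ((H.hasDerivAt₁ (h t).1).comp t h1).mul h2 using 1
  simp [jetAct]
  ring

theorem IsSigmoidal.isJetOf_jetRun (H : IsSigmoidal ρ ρ₁ ρ₂) :
    ∀ (M : ℕ) (w : Fin M → Fin N → Option (Fin N) → ℝ) {h : ℝ → Fin N → Jet},
    (∀ t, IsJetOf fun s => h s t) → ∀ t, IsJetOf fun s => jetRun ρ ρ₁ ρ₂ M w (h s) t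
  | 0, _, _, hh => hh
  | M + 1, w, _, hh => H.isJetOf_jetRun M _ fun t => H.isJetOf_jetAct (isJetOf_jetAff (w 0 t) hh)

theorem IsSigmoidal.isJetOf_netJet (H : IsSigmoidal ρ ρ₁ ρ₂) (p : ParamIdx d N M → ℝ)
    (x : Fin d → ℝ) (k : Fin d) :
    IsJetOf fun s => netJet ρ ρ₁ ρ₂ p (fun c => x c + s * if c = k then 1 else 0) k := by
  refine isJetOf_jetAff _ (H.isJetOf_jetRun M _ fun t => H.isJetOf_jetAct (isJetOf_jetAff _ ?_))
  intro c s
  refine ⟨?_, hasDerivAt_const _ _⟩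
  simpa [inputJet] using ((hasDerivAt_id s).mul_const (if c = k then (1 : ℝ) else 0)).const_add (x c)

theorem hasDerivAt_line {E : Type*} [NormedAddCommGroup E] [NormedSpace ℝ E] {f : E → ℝ}
    (hf : ContDiff ℝ 2 f) (x e : E) (s : ℝ) :
    HasDerivAt (fun s : ℝ => f (x + s • e)) (fderiv ℝ f (x + s • e) e) s ∧
    HasDerivAt (fun s : ℝ => fderiv ℝ f (x + s • e) e)
      (fderiv ℝ (fderiv ℝ f) (x + s • e) e e) s := by
  have hL : HasDerivAt (fun s : ℝ => x + s • e) e s := by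
    simpa using ((hasDerivAt_id s).smul_const e).const_add x
  constructor
  · have h1 : HasFDerivAt f (fderiv ℝ f (x + s • e)) (x + s • e) :=
      (hf.differentiable (by norm_num) _).hasFDerivAt
    exact HasFDerivAt.comp_hasDerivAt (f := fun s : ℝ => x + s • e) s h1 hL
  · have hD : HasFDerivAt (fderiv ℝ f) (fderiv ℝ (fderiv ℝ f) (x + s • e)) (x + s • e) :=
      ((hf.fderiv_right (m := 1) (by norm_num)).differentiable (by norm_num) _).hasFDerivAt
    have h1 : HasDerivAt (fun s : ℝ => fderiv ℝ f (x + s • e))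
        (fderiv ℝ (fderiv ℝ f) (x + s • e) e) s :=
      HasFDerivAt.comp_hasDerivAt (f := fun s : ℝ => x + s • e) s hD hL
    have h2 := h1.clm_apply (hasDerivAt_const s e)
    simpa using h2

/-- A `C²` function whose restriction to a line has a known jet. -/
theorem fderiv_fderiv_eq_of_isJetOf {E : Type*} [NormedAddCommGroup E] [NormedSpace ℝ E]
    {f : E → ℝ} (hf : ContDiff ℝ 2 f) (x e : E) {h : ℝ → Jet} (hh : IsJetOf h)
    (hfh : ∀ s : ℝ, f (x + s • e) = (h s).1) : fderiv ℝ (fderiv ℝ f) x e e = (h 0).2.2 := by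
  have h1 : ∀ s : ℝ, fderiv ℝ f (x + s • e) e = (h s).2.1 := fun s => by
    have ha := (hasDerivAt_line hf x e s).1
    simp only [hfh] at ha
    exact ha.unique (hh s).1
  have ha := (hasDerivAt_line hf x e 0).2
  simp only [h1] at ha
  simpa using ha.unique (hh 0).2

/-- The chain rule is only carried out along coordinate lines. Since the network is known to be
`C²`, uniqueness of derivatives identifies the diagonal entries of its Hessian with the second jet
components. -/
theorem IsSigmoidal.laplacian_netJet (H : IsSigmoidal ρ ρ₁ ρ₂) (p : ParamIdx d N M → ℝ)
    (k₀ : Fin d) (x : EuclideanSpace ℝ (Fin d)) :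
    Laplacian.laplacian (fun x : EuclideanSpace ℝ (Fin d) =>
      (netJet ρ ρ₁ ρ₂ p (fun i => x i) k₀).1) x =
      ∑ k, (netJet ρ ρ₁ ρ₂ p (fun i => x i) k).2.2 := by
  rw [InnerProductSpace.laplacian_eq_iteratedFDeriv_orthonormalBasis _
    (EuclideanSpace.basisFun (Fin d) ℝ)]
  refine Finset.sum_congr rfl fun k _ => ?_
  rw [iteratedFDeriv_two_apply]
  have := fderiv_fderiv_eq_of_isJetOf (H.contDiff_netJet p k₀) x
    (EuclideanSpace.basisFun (Fin d) ℝ k) (H.isJetOf_netJet p (fun i => x i) k) fun s => by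
      rw [netJet_fst_eq _ _ k₀ k]
      congr 2
      funext c
      simp [EuclideanSpace.basisFun_apply]
  simpa using this

end Jets

/-! ### Growth and stability of jets through the layers -/

theorem abs_sum_mul_le {k : ℕ} {w h : Fin k → ℝ} {R D : ℝ} (hR : 0 ≤ R) (hw : ∀ c, |w c| ≤ R)
    (hh : ∀ c, |h c| ≤ D) : |∑ c, w c * h c| ≤ k * R * D := by
  calc _ ≤ ∑ c, |w c * h c| := Finset.abs_sum_le_sum_abs _ _
    _ ≤ ∑ _c : Fin k, R * D := Finset.sum_le_sum fun c _ => by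
        rw [abs_mul]
        exact mul_le_mul (hw c) (hh c) (abs_nonneg _) hR
    _ = _ := by simp; ring

theorem abs_sum_mul_sub_le {k : ℕ} {w w' h h' : Fin k → ℝ} {R D δ η : ℝ} (hR : 0 ≤ R)
    (hδ : 0 ≤ δ) (hw' : ∀ c, |w' c| ≤ R) (hww : ∀ c, |w c - w' c| ≤ δ) (hh : ∀ c, |h c| ≤ D)
    (hhh : ∀ c, |h c - h' c| ≤ η) :
    |∑ c, w c * h c - ∑ c, w' c * h' c| ≤ k * (δ * D + R * η) := by
  have h1 : ∑ c, w c * h c - ∑ c, w' c * h' c =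
      ∑ c, (w c - w' c) * h c + ∑ c, w' c * (h c - h' c) := by
    rw [← Finset.sum_sub_distrib, ← Finset.sum_add_distrib]
    exact Finset.sum_congr rfl fun c _ => by ring
  rw [h1]
  refine (abs_add_le _ _).trans ?_
  linarith [abs_sum_mul_le hδ hww hh, abs_sum_mul_le hR hw' hhh]

theorem abs_mul_sub_mul_le {a a' b b' : ℝ} : |a * b - a' * b'| ≤ |a - a'| * |b| + |a'| * |b - b'| := by
  rw [← abs_mul, ← abs_mul]
  refine le_trans (le_of_eq ?_) (abs_add_le _ _)
  congr 1
  ring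

section Jets

/-- Bounds for the components of a jet. -/
structure JetBdd (D S : ℝ) (j : Jet) : Prop where
  val : |j.1| ≤ 1
  fst : |j.2.1| ≤ D
  snd : |j.2.2| ≤ S

/-- Componentwise closeness of jets. -/
structure JetClose (η : ℝ) (j j' : Jet) : Prop where
  val : |j.1 - j'.1| ≤ η
  fst : |j.2.1 - j'.2.1| ≤ η
  snd : |j.2.2 - j'.2.2| ≤ η

variable {ρ ρ₁ ρ₂ : ℝ → ℝ} {d N M : ℕ} {R : ℝ}

theorem IsSigmoidal.lip (H : IsSigmoidal ρ ρ₁ ρ₂) (y z : ℝ) : |ρ y - ρ z| ≤ |y - z| := by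
  have := Convex.norm_image_sub_le_of_norm_hasDerivWithin_le (f := ρ) (f' := ρ₁) (C := 1)
    (s := Set.univ) (x := z) (y := y) (fun z _ => (H.hasDerivAt z).hasDerivWithinAt)
    (fun z _ => H.abs_le₁ z) convex_univ trivial trivial
  simpa using this

theorem IsSigmoidal.jetBdd_jetAct (H : IsSigmoidal ρ ρ₁ ρ₂) {j : Jet} {D S : ℝ}
    (h1 : |j.2.1| ≤ D) (h2 : |j.2.2| ≤ S) :
    JetBdd D (2 * D ^ 2 + S) (jetAct ρ ρ₁ ρ₂ j) := by
  refine ⟨H.abs_le _, ?_, ?_⟩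
  · simp only [jetAct, abs_mul]
    exact (mul_le_of_le_one_left (abs_nonneg _) (H.abs_le₁ _)).trans h1
  · simp only [jetAct]
    refine (abs_add_le _ _).trans (add_le_add ?_ ?_)
    · rw [abs_mul, abs_pow]
      exact mul_le_mul (H.abs_le₂ _) (pow_le_pow_left₀ (abs_nonneg _) h1 2) (by positivity)
        (by norm_num)
    · rw [abs_mul]
      exact (mul_le_of_le_one_left (abs_nonneg _) (H.abs_le₁ _)).trans h2

/-- The hypothesis `h0` compares activations, not pre-activations, because in the first layer only
the former are controlled uniformly in `x`; `lip₁` and `lip₂` transfer it to the derivatives. In the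
second component, `12 = 8 + 2 * 2` comes from `ρ₂ * u' ^ 2`, and `3 = 2 + 1` from `ρ₁ * u''`. -/
theorem IsSigmoidal.jetClose_jetAct (H : IsSigmoidal ρ ρ₁ ρ₂) {j j' : Jet} {B ε : ℝ} (hB : 1 ≤ B)
    (hε : 0 ≤ ε) (h0 : |ρ j.1 - ρ j'.1| ≤ ε) (h1 : |j.2.1| ≤ B) (h1' : |j'.2.1| ≤ B)
    (h2 : |j.2.2| ≤ B) (hd1 : |j.2.1 - j'.2.1| ≤ ε) (hd2 : |j.2.2 - j'.2.2| ≤ ε) :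
    JetClose (15 * B ^ 2 * ε) (jetAct ρ ρ₁ ρ₂ j) (jetAct ρ ρ₁ ρ₂ j') := by
  have hB2 : B ≤ B ^ 2 := by nlinarith
  have hεB : ε * B ≤ ε * B ^ 2 := mul_le_mul_of_nonneg_left hB2 hε
  have hεB1 : ε ≤ ε * B ^ 2 := by nlinarith
  have hρ1 : |ρ₁ j.1 - ρ₁ j'.1| ≤ 2 * ε := (H.lip₁ _ _).trans (by linarith)
  have hρ2 : |ρ₂ j.1 - ρ₂ j'.1| ≤ 8 * ε := (H.lip₂ _ _).trans (by linarith)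
  have hprod : ∀ x x' : ℝ, |x| ≤ B → |x - x'| ≤ ε →
      |ρ₁ j.1 * x - ρ₁ j'.1 * x'| ≤ 3 * (ε * B ^ 2) := fun x x' hx hxx => by
    refine abs_mul_sub_mul_le.trans ?_
    have e1 : |ρ₁ j.1 - ρ₁ j'.1| * |x| ≤ 2 * ε * B :=
      mul_le_mul hρ1 hx (abs_nonneg _) (by linarith)
    have e2 : |ρ₁ j'.1| * |x - x'| ≤ 1 * ε :=
      mul_le_mul (H.abs_le₁ _) hxx (abs_nonneg _) (by norm_num)
    linarith
  refine ⟨?_, ?_, ?_⟩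
  · simp only [jetAct]
    linarith
  · simp only [jetAct]
    linarith [hprod _ _ h1 hd1]
  · simp only [jetAct]
    have e1 : |ρ₂ j.1 * j.2.1 ^ 2 - ρ₂ j'.1 * j'.2.1 ^ 2| ≤ 12 * (ε * B ^ 2) := by
      refine abs_mul_sub_mul_le.trans ?_
      have e1 : |ρ₂ j.1 - ρ₂ j'.1| * |j.2.1 ^ 2| ≤ 8 * ε * B ^ 2 := by
        rw [abs_pow]
        exact mul_le_mul hρ2 (pow_le_pow_left₀ (abs_nonneg _) h1 2) (by positivity) (by linarith)
      have e2 : |j.2.1 ^ 2 - j'.2.1 ^ 2| ≤ 2 * B * ε := by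
        have : j.2.1 ^ 2 - j'.2.1 ^ 2 = (j.2.1 + j'.2.1) * (j.2.1 - j'.2.1) := by ring
        rw [this, abs_mul]
        exact mul_le_mul ((abs_add_le _ _).trans (by linarith)) hd1 (abs_nonneg _) (by linarith)
      have e3 : |ρ₂ j'.1| * |j.2.1 ^ 2 - j'.2.1 ^ 2| ≤ 2 * (2 * B * ε) :=
        mul_le_mul (H.abs_le₂ _) e2 (abs_nonneg _) (by norm_num)
      linarith
    have e4 := hprod _ _ h2 hd2
    have e5 : (ρ₂ j.1 * j.2.1 ^ 2 + ρ₁ j.1 * j.2.2) - (ρ₂ j'.1 * j'.2.1 ^ 2 + ρ₁ j'.1 * j'.2.2) =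
      (ρ₂ j.1 * j.2.1 ^ 2 - ρ₂ j'.1 * j'.2.1 ^ 2) + (ρ₁ j.1 * j.2.2 - ρ₁ j'.1 * j'.2.2) := by ring
    rw [e5]
    refine (abs_add_le _ _).trans ?_
    linarith

/-- Three contributions, each at most `N * R * B * η`: perturbed weights, perturbed inputs and, for
the value, the perturbed bias. The condition `δ ≤ η` absorbs the parameter errors into the incoming
error. -/
theorem jetClose_jetAff (hR : 1 ≤ R) (hN : 1 ≤ N) {w w' : Option (Fin N) → ℝ} {h h' : Fin N → Jet}
    {B δ η : ℝ} (hB : 1 ≤ B) (hδ : 0 ≤ δ) (hδη : δ ≤ η) (hw' : ∀ o, |w' o| ≤ R)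
    (hww : ∀ o, |w o - w' o| ≤ δ) (hh : ∀ c, JetBdd B B (h c))
    (hhh : ∀ c, JetClose η (h c) (h' c)) :
    JetClose (3 * (N * R * B) * η) (jetAff w h) (jetAff w' h') := by
  have hN' : (1 : ℝ) ≤ N := by exact_mod_cast hN
  have hη : 0 ≤ η := hδ.trans hδη
  have k1 : 1 ≤ R * B := by nlinarith
  have k2 : 1 ≤ N * R * B := by nlinarith
  have k3 : η ≤ N * R * B * η := le_mul_of_one_le_left hη k2
  have k4 : N * (δ * B) ≤ N * R * B * η := by
    have : δ * B ≤ η * (R * B) := mul_le_mul hδη (by nlinarith) (by linarith) hη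
    calc N * (δ * B) ≤ N * (η * (R * B)) := by gcongr
      _ = _ := by ring
  have k5 : N * (R * η) ≤ N * R * B * η := by
    have : N * R * η * 1 ≤ N * R * η * B := by gcongr
    linarith
  refine ⟨?_, ?_, ?_⟩ <;> simp only [jetAff]
  · have e := abs_sum_mul_sub_le (by linarith) hδ (fun c => hw' (some c)) (fun c => hww (some c))
      (fun c => (hh c).val.trans hB) (fun c => (hhh c).val)
    have e2 := hww none
    rw [add_sub_add_comm]
    refine (abs_add_le _ _).trans ?_
    linarith
  · have e := abs_sum_mul_sub_le (by linarith) hδ (fun c => hw' (some c)) (fun c => hww (some c))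
      (fun c => (hh c).fst) (fun c => (hhh c).fst)
    linarith
  · have e := abs_sum_mul_sub_le (by linarith) hδ (fun c => hw' (some c)) (fun c => hww (some c))
      (fun c => (hh c).snd) (fun c => (hhh c).snd)
    linarith

/-- With `D' = N * R * D`, the new second derivative is at most `2 * D' ^ 2 + N * R * (2 * l * D ^
2)`. As `N * R ≥ 1`, the last term is at most `2 * l * D' ^ 2`, so the coefficient grows only
linearly with depth. -/
theorem IsSigmoidal.jetBdd_layer (H : IsSigmoidal ρ ρ₁ ρ₂) (hR : 1 ≤ R) (hN : 1 ≤ N)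
    {w : Option (Fin N) → ℝ} (hw : ∀ o, |w o| ≤ R) {h : Fin N → Jet} {D : ℝ} {l : ℕ}
    (hh : ∀ c, JetBdd D (2 * l * D ^ 2) (h c)) :
    JetBdd (N * R * D) (2 * (l + 1 : ℕ) * (N * R * D) ^ 2) (jetAct ρ ρ₁ ρ₂ (jetAff w h)) := by
  have hN' : (1 : ℝ) ≤ N := by exact_mod_cast hN
  have hQ : 1 ≤ N * R := by nlinarith
  have h1 := abs_sum_mul_le (by linarith) (fun c => hw (some c)) (fun c => (hh c).fst)
  have h2 := abs_sum_mul_le (by linarith) (fun c => hw (some c)) (fun c => (hh c).snd)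
  have := H.jetBdd_jetAct (j := jetAff w h) h1 h2
  refine ⟨this.val, this.fst, this.snd.trans ?_⟩
  have : N * R * (2 * l * D ^ 2) ≤ (N * R) * (N * R * (2 * l * D ^ 2)) :=
    le_mul_of_one_le_left (by positivity) hQ
  push_cast
  nlinarith

theorem IsSigmoidal.jetBdd_jetRun (H : IsSigmoidal ρ ρ₁ ρ₂) (hR : 1 ≤ R) (hN : 1 ≤ N) :
    ∀ (M : ℕ) {w : Fin M → Fin N → Option (Fin N) → ℝ} (_ : ∀ m t o, |w m t o| ≤ R)
    {h : Fin N → Jet} {D : ℝ} {l : ℕ} (_ : ∀ c, JetBdd D (2 * l * D ^ 2) (h c)) (t : Fin N),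
    JetBdd ((N * R) ^ M * D) (2 * (l + M : ℕ) * ((N * R) ^ M * D) ^ 2) (jetRun ρ ρ₁ ρ₂ M w h t)
  | 0, _, _, _, _, _, hh, t => by simpa [jetRun] using hh t
  | M + 1, w, hw, h, D, l, hh, t => by
      have := H.jetBdd_jetRun hR hN M (fun m => hw m.succ)
        (fun c => H.jetBdd_layer hR hN (hw 0 c) hh) t
      rw [show l + (M + 1) = l + 1 + M by ring, pow_succ, mul_assoc]
      exact this

theorem IsSigmoidal.jetClose_jetRun (H : IsSigmoidal ρ ρ₁ ρ₂) (hR : 1 ≤ R) (hN : 1 ≤ N) {B δ : ℝ}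
    (hB : 1 ≤ B) (hδ : 0 ≤ δ) : ∀ (M : ℕ) {w w' : Fin M → Fin N → Option (Fin N) → ℝ}
    (_ : ∀ m t o, |w m t o| ≤ R) (_ : ∀ m t o, |w' m t o| ≤ R)
    (_ : ∀ m t o, |w m t o - w' m t o| ≤ δ)
    {h h' : Fin N → Jet} {D η : ℝ} {l : ℕ} (_ : 1 ≤ D) (_ : 1 ≤ l)
    (_ : 2 * (l + M : ℕ) * ((N * R) ^ M * D) ^ 2 ≤ B) (_ : δ ≤ η)
    (_ : ∀ c, JetBdd D (2 * l * D ^ 2) (h c)) (_ : ∀ c, JetBdd D (2 * l * D ^ 2) (h' c))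
    (_ : ∀ c, JetClose η (h c) (h' c)) (t : Fin N),
    JetClose ((45 * (N * R * B) ^ 3) ^ M * η) (jetRun ρ ρ₁ ρ₂ M w h t) (jetRun ρ ρ₁ ρ₂ M w' h' t)
  | 0, _, _, _, _, _, _, _, _, _, _, _, _, _, _, _, _, hhh, t => by simpa [jetRun] using hhh t
  | M + 1, w, w', hw, hw', hww, h, h', D, η, l, hD, hl, hDB, hδη, hh, hh', hhh, t => by
      have hN' : (1 : ℝ) ≤ N := by exact_mod_cast hN
      have hl' : (1 : ℝ) ≤ l := by exact_mod_cast hl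
      have hη : 0 ≤ η := hδ.trans hδη
      have hQ : 1 ≤ N * R := by nlinarith
      have hQB : 1 ≤ N * R * B := by nlinarith
      have hD2 : D ≤ D ^ 2 := by nlinarith
      have hSB : 2 * l * D ^ 2 ≤ B := by
        refine le_trans ?_ hDB
        have : D ≤ (N * R) ^ (M + 1) * D := le_mul_of_one_le_left (by linarith) (one_le_pow₀ hQ)
        gcongr
        omega
      have hDB' : D ≤ B := by nlinarith
      have hb : ∀ {h : Fin N → Jet}, (∀ c, JetBdd D (2 * l * D ^ 2) (h c)) →
        ∀ c, JetBdd B B (h c) := fun hh c =>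
          ⟨(hh c).val, (hh c).fst.trans hDB', (hh c).snd.trans hSB⟩
      -- An affine map costs `3 * (N * R * B)` and the activation `15 * (N * R * B) ^ 2`, whence the
      -- factor `45 * (N * R * B) ^ 3` per layer.
      have hstep : ∀ c, JetClose (45 * (N * R * B) ^ 3 * η) (jetAct ρ ρ₁ ρ₂ (jetAff (w 0 c) h))
          (jetAct ρ ρ₁ ρ₂ (jetAff (w' 0 c) h')) := fun c => by
        have e := jetClose_jetAff hR hN hB hδ hδη (hw' 0 c) (hww 0 c) (hb hh) hhh
        have := H.jetClose_jetAct hQB (by positivity) ((H.lip _ _).trans e.val)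
          (abs_sum_mul_le (by linarith) (fun s => hw 0 c (some s)) (fun s => (hb hh s).fst))
          (abs_sum_mul_le (by linarith) (fun s => hw' 0 c (some s)) (fun s => (hb hh' s).fst))
          (abs_sum_mul_le (by linarith) (fun s => hw 0 c (some s)) (fun s => (hb hh s).snd))
          e.fst e.snd
        convert this using 1
        ring
      have hbig : (1 : ℝ) ≤ 45 * (N * R * B) ^ 3 := by
        have := one_le_pow₀ (n := 3) hQB
        linarith
      have := H.jetClose_jetRun hR hN hB hδ M (fun m => hw m.succ) (fun m => hw' m.succ)
        (fun m => hww m.succ) (D := N * R * D) (η := 45 * (N * R * B) ^ 3 * η) (l := l + 1)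
        (by nlinarith) (by omega)
        (by rw [show l + 1 + M = l + (M + 1) by ring, ← mul_assoc, ← pow_succ]; exact hDB)
        (hδη.trans (le_mul_of_one_le_left hη hbig))
        (fun c => H.jetBdd_layer hR hN (hw 0 c) hh) (fun c => H.jetBdd_layer hR hN (hw' 0 c) hh')
        hstep t
      rw [pow_succ, mul_assoc]
      exact this

/-- Differentiating in a coordinate direction selects a single weight, so the first-layer
derivatives are bounded independently of `d` and `x`. -/
theorem jetAff_inputJet_snd (w : Option (Fin d) → ℝ) (x : Fin d → ℝ) (k : Fin d) :
    (jetAff w (inputJet x k)).2 = (w (some k), 0) := by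
  simp [jetAff, inputJet]

theorem IsSigmoidal.jetBdd_firstJet (H : IsSigmoidal ρ ρ₁ ρ₂) {p : ParamIdx d N M → ℝ}
    (hp : ∀ i, |p i| ≤ R) (x : Fin d → ℝ) (k : Fin d) (t : Fin N) :
    JetBdd R (2 * (1 : ℕ) * R ^ 2) (firstJet ρ ρ₁ ρ₂ p x k t) := by
  have := H.jetBdd_jetAct (j := jetAff (fun o => p (.inl (t, o))) (inputJet x k)) (D := R) (S := 0)
    (by rw [jetAff_inputJet_snd]; exact hp _) (by rw [jetAff_inputJet_snd]; simp)
  simpa [firstJet] using this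

theorem IsSigmoidal.abs_netJet_fst_le (H : IsSigmoidal ρ ρ₁ ρ₂) (hR : 1 ≤ R) (hN : 1 ≤ N)
    {p : ParamIdx d N M → ℝ} (hp : ∀ i, |p i| ≤ R) (x : Fin d → ℝ) (k : Fin d) :
    |(netJet ρ ρ₁ ρ₂ p x k).1| ≤ N * R + R := by
  have h1 := H.jetBdd_jetRun hR hN M (fun l t o => hp (.inr (.inl (l, t, o))))
    (fun t => H.jetBdd_firstJet hp x k t)
  have h2 := abs_sum_mul_le (by linarith) (fun c => hp (.inr (.inr (some c))))
    (fun c => (h1 c).val)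
  refine (abs_add_le _ _).trans (add_le_add ?_ (hp _))
  simpa using h2

theorem IsSigmoidal.abs_netJet_snd_le (H : IsSigmoidal ρ ρ₁ ρ₂) (hR : 1 ≤ R) (hN : 1 ≤ N)
    {p : ParamIdx d N M → ℝ} (hp : ∀ i, |p i| ≤ R) (x : Fin d → ℝ) (k : Fin d) :
    |(netJet ρ ρ₁ ρ₂ p x k).2.2| ≤ N * R * (2 * (1 + M : ℕ) * ((N * R) ^ M * R) ^ 2) :=
  abs_sum_mul_le (by linarith) (fun c => hp (.inr (.inr (some c))))
    fun c => (H.jetBdd_jetRun hR hN M (fun l t o => hp (.inr (.inl (l, t, o))))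
      (fun t => H.jetBdd_firstJet hp x k t) c).snd

/-- Hypothesis `hx` is what the net provides at a sample point, and no bound on `x` enters. The two
extra powers in `M + 2` absorb the first layer's factor `15 * R ^ 2` and the output layer's `3 * (N
* R * B)`. -/
theorem IsSigmoidal.jetClose_netJet (H : IsSigmoidal ρ ρ₁ ρ₂) (hR : 1 ≤ R) (hN : 1 ≤ N) {B δ : ℝ}
    (hB : 2 * (1 + M : ℕ) * ((N * R) ^ M * R) ^ 2 ≤ B) (hδ : 0 ≤ δ)
    {p p' : ParamIdx d N M → ℝ} (hp : ∀ i, |p i| ≤ R) (hp' : ∀ i, |p' i| ≤ R)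
    (hpp : ∀ i, |p i - p' i| ≤ δ) {x : Fin d → ℝ} (k : Fin d)
    (hx : ∀ t, |ρ (∑ c, p (.inl (t, some c)) * x c + p (.inl (t, none))) -
      ρ (∑ c, p' (.inl (t, some c)) * x c + p' (.inl (t, none)))| ≤ δ) :
    JetClose ((45 * (N * R * B) ^ 3) ^ (M + 2) * δ) (netJet ρ ρ₁ ρ₂ p x k)
      (netJet ρ ρ₁ ρ₂ p' x k) := by
  have hN' : (1 : ℝ) ≤ N := by exact_mod_cast hN
  have hQ : 1 ≤ N * R := by nlinarith
  have hD : R ≤ (N * R) ^ M * R := le_mul_of_one_le_left (by linarith) (one_le_pow₀ hQ)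
  have hD2 : ((N * R) ^ M * R) ≤ ((N * R) ^ M * R) ^ 2 := by nlinarith
  have hDS : ((N * R) ^ M * R) ^ 2 ≤ 2 * (1 + M : ℕ) * ((N * R) ^ M * R) ^ 2 := by
    refine le_mul_of_one_le_left (by positivity) ?_
    push_cast
    linarith [(Nat.cast_nonneg M : (0 : ℝ) ≤ M)]
  have hDB : (N * R) ^ M * R ≤ B := by linarith
  have hB1 : 1 ≤ B := by linarith
  have hQB : R ≤ N * R * B := by nlinarith
  have h0 : ∀ t, JetClose (15 * R ^ 2 * δ) (firstJet ρ ρ₁ ρ₂ p x k t)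
      (firstJet ρ ρ₁ ρ₂ p' x k t) := fun t => by
    refine H.jetClose_jetAct hR hδ (by simpa [jetAff, inputJet] using hx t) ?_ ?_ ?_ ?_ ?_ <;>
      simp only [jetAff_inputJet_snd]
    · exact hp _
    · exact hp' _
    · rw [abs_zero]
      linarith
    · exact hpp _
    · rwa [sub_zero, abs_zero]
  have hR2 : (1 : ℝ) ≤ R ^ 2 := by nlinarith
  have hb : ∀ {p : ParamIdx d N M → ℝ}, (∀ i, |p i| ≤ R) → ∀ c, JetBdd B B (jetRun ρ ρ₁ ρ₂ M
      (fun l t o => p (.inr (.inl (l, t, o)))) (firstJet ρ ρ₁ ρ₂ p x k) c) := fun hp c => by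
    have := H.jetBdd_jetRun hR hN M (fun l t o => hp (.inr (.inl (l, t, o))))
      (fun t => H.jetBdd_firstJet hp x k t) c
    exact ⟨this.val, this.fst.trans hDB, this.snd.trans hB⟩
  have h1 := H.jetClose_jetRun hR hN hB1 hδ M (fun l t o => hp (.inr (.inl (l, t, o))))
    (fun l t o => hp' (.inr (.inl (l, t, o)))) (fun l t o => hpp (.inr (.inl (l, t, o))))
    hR le_rfl hB (by nlinarith) (fun t => H.jetBdd_firstJet hp x k t)
    (fun t => H.jetBdd_firstJet hp' x k t) h0
  have hbig : (1 : ℝ) ≤ (45 * (N * R * B) ^ 3) ^ M := by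
    refine one_le_pow₀ ?_
    have := one_le_pow₀ (n := 3) (hR.trans hQB)
    linarith
  have h2 := jetClose_jetAff hR hN hB1 hδ (η := (45 * (N * R * B) ^ 3) ^ M * (15 * R ^ 2 * δ))
    (by
      have : δ ≤ 15 * R ^ 2 * δ := le_mul_of_one_le_left hδ (by linarith)
      exact this.trans (le_mul_of_one_le_left (by positivity) hbig))
    (fun o => hp' (.inr (.inr o))) (fun o => hpp (.inr (.inr o))) (hb hp) h1
  have hfin : 3 * (N * R * B) * ((45 * (N * R * B) ^ 3) ^ M * (15 * R ^ 2 * δ)) ≤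
      (45 * (N * R * B) ^ 3) ^ (M + 2) * δ := by
    set Z := N * R * B
    have hZ : 1 ≤ Z := hR.trans hQB
    have hRZ : R ^ 2 ≤ Z ^ 2 := by gcongr
    have hc : 45 * Z * R ^ 2 ≤ (45 * Z ^ 3) ^ 2 := by
      have e1 : 45 * Z * R ^ 2 ≤ 45 * Z ^ 3 := by nlinarith
      have e2 : 1 ≤ 45 * Z ^ 3 := by
        have := one_le_pow₀ (n := 3) hZ
        linarith
      nlinarith
    calc _ = (45 * Z ^ 3) ^ M * (45 * Z * R ^ 2) * δ := by ring
      _ ≤ (45 * Z ^ 3) ^ M * (45 * Z ^ 3) ^ 2 * δ := by gcongr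
      _ = _ := by ring
  exact ⟨h2.val.trans hfin, h2.fst.trans hfin, h2.snd.trans hfin⟩

end Jets

/-! ### Reduction to uniform width by sparsity -/

section Padding

/-- `1` for a nonzero parameter, `0` otherwise. -/
noncomputable def nzInd (z : ℝ) : ℕ := if z = 0 then 0 else 1

@[simp]
theorem nzInd_zero : nzInd 0 = 0 := if_pos rfl

theorem nzInd_pos {z : ℝ} (hz : z ≠ 0) : 1 ≤ nzInd z := by simp [nzInd, hz]

theorem sum_nzInd {ι : Type*} [Fintype ι] (f : ι → ℝ) :
    ∑ i, nzInd (f i) = (Finset.univ.filter fun i => f i ≠ 0).card := by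
  rw [Finset.card_filter]
  exact Finset.sum_congr rfl fun i _ => by by_cases h : f i = 0 <;> simp [nzInd, h]

theorem DNN.layerNonzeros_eq {k d : ℕ} (W : Matrix (Fin k) (Fin d) ℝ) (b : Fin k → ℝ) :
    DNN.layerNonzeros W b = ∑ r, (nzInd (b r) + ∑ c, nzInd (W r c)) := by
  classical
  have h1 := sum_nzInd (fun q : Fin k × Fin d => W q.1 q.2)
  rw [Fintype.sum_prod_type] at h1
  rw [DNN.layerNonzeros, Set.ncard_eq_toFinset_card', Set.ncard_eq_toFinset_card',
    Set.toFinset_ofPred, Set.toFinset_ofPred, ← h1, ← sum_nzInd, Finset.sum_add_distrib, add_comm]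

variable {N k : ℕ}

theorem sum_option_elim {A : Type*} [AddCommMonoid A] (e : Fin N → Option (Fin k))
    (F : Fin k → A) :
    ∑ t, (e t).elim 0 F = ∑ r, ∑ t, if e t = some r then F r else 0 := by
  rw [Finset.sum_comm]
  refine Finset.sum_congr rfl fun t _ => ?_
  cases h : e t <;> simp

/-- `e` is a partial injection. -/
def PartialInj (e : Fin N → Option (Fin k)) : Prop :=
  ∀ t t' r, e t = some r → e t' = some r → t = t'

theorem PartialInj.sum_ite {A : Type*} [AddCommMonoid A] {e : Fin N → Option (Fin k)}
    (he : PartialInj e) {r : Fin k} {t₀ : Fin N} (h : e t₀ = some r) (a : A) :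
    (∑ t, if e t = some r then a else 0) = a := by
  rw [Finset.sum_eq_single t₀ (fun t _ ht => if_neg fun h' => ht (he _ _ _ h' h)) (by simp),
    if_pos h]

theorem PartialInj.sum_elim_le {e : Fin N → Option (Fin k)} (he : PartialInj e) (F : Fin k → ℕ) :
    ∑ t, (e t).elim 0 F ≤ ∑ r, F r := by
  rw [sum_option_elim]
  refine Finset.sum_le_sum fun r _ => ?_
  by_cases h : ∃ t, e t = some r
  · obtain ⟨t, ht⟩ := h
    rw [he.sum_ite ht]
  · rw [Finset.sum_eq_zero fun t _ => if_neg fun h' => h ⟨t, h'⟩]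
    exact Nat.zero_le _

theorem PartialInj.sum_elim_eq {e : Fin N → Option (Fin k)} (he : PartialInj e) {F : Fin k → ℝ}
    (hF : ∀ r, F r ≠ 0 → ∃ t, e t = some r) : ∑ t, (e t).elim 0 F = ∑ r, F r := by
  rw [sum_option_elim]
  refine Finset.sum_congr rfl fun r _ => ?_
  by_cases h : F r = 0
  · simp [h]
  · obtain ⟨t, ht⟩ := hF r h
    exact he.sum_ite ht _

theorem exists_partialInj (S : Finset (Fin k)) (hS : S.card ≤ N) :
    ∃ e : Fin N → Option (Fin k), PartialInj e ∧ ∀ c ∈ S, ∃ t, e t = some c := by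
  refine ⟨fun t => if h : (t : ℕ) < S.card then some (S.equivFin.symm ⟨t, h⟩) else none, ?_, ?_⟩
  · intro t t' r h h'
    simp only at h h'
    split_ifs at h h' with h1 h2
    have := (Option.some.inj h).trans (Option.some.inj h').symm
    have := S.equivFin.symm.injective (Subtype.ext this)
    simp only [Fin.mk.injEq] at this
    exact Fin.ext this
  · intro c hc
    refine ⟨⟨S.equivFin ⟨c, hc⟩, lt_of_lt_of_le (Fin.is_lt _) hS⟩, ?_⟩
    simp

/-- A matrix with at most `N` nonzero entries has at most `N` nonzero columns, so `N` slots suffice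
for the inputs that matter. -/
theorem exists_partialInj_columns {m : ℕ} (W : Matrix (Fin m) (Fin k) ℝ)
    (hW : ∑ r, ∑ c, nzInd (W r c) ≤ N) :
    ∃ e : Fin N → Option (Fin k), PartialInj e ∧ ∀ r c, W r c ≠ 0 → ∃ t, e t = some c := by
  classical
  obtain ⟨e, he, h⟩ := exists_partialInj (N := N)
    (Finset.univ.filter fun c => ∃ r, W r c ≠ 0) (by
      refine le_trans ?_ hW
      rw [Finset.card_filter, Finset.sum_comm]
      refine Finset.sum_le_sum fun c _ => ?_
      split_ifs with hc
      · obtain ⟨r, hr⟩ := hc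
        exact (nzInd_pos hr).trans
          (Finset.single_le_sum (f := fun r => nzInd (W r c)) (fun _ _ => Nat.zero_le _)
            (Finset.mem_univ r))
      · exact Nat.zero_le _)
  exact ⟨e, he, fun r c hrc => h c (by simpa using ⟨r, hrc⟩)⟩

/-- A row of weights (and its bias) read off through a partial injection of the inputs. -/
def padRow (e : Fin N → Option (Fin k)) (a : Fin k → ℝ) (β : ℝ) : Option (Fin N) → ℝ :=
  fun o => o.elim β fun s => (e s).elim 0 a

theorem abs_padRow_le {e : Fin N → Option (Fin k)} {a : Fin k → ℝ} {β R : ℝ} (hR : 0 ≤ R)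
    (ha : ∀ c, |a c| ≤ R) (hβ : |β| ≤ R) (o : Option (Fin N)) : |padRow e a β o| ≤ R := by
  cases o with
  | none => exact hβ
  | some s => cases h : e s <;> simp [padRow, h, hR, ha]

theorem PartialInj.sum_nzInd_padRow_le {e : Fin N → Option (Fin k)} (he : PartialInj e)
    (a : Fin k → ℝ) (β : ℝ) : ∑ o, nzInd (padRow e a β o) ≤ nzInd β + ∑ c, nzInd (a c) := by
  rw [Fintype.sum_option]
  refine Nat.add_le_add_left (le_trans (le_of_eq ?_) (he.sum_elim_le _)) _
  refine Finset.sum_congr rfl fun s _ => ?_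
  cases h : e s <;> simp [padRow, h]

theorem PartialInj.jetAff_padRow_fst {e : Fin N → Option (Fin k)} (he : PartialInj e)
    {a : Fin k → ℝ} (ha : ∀ c, a c ≠ 0 → ∃ t, e t = some c) (β : ℝ) {h : Fin N → Jet}
    {y : Fin k → ℝ} (hy : ∀ t r, e t = some r → (h t).1 = y r) :
    (jetAff (padRow e a β) h).1 = ∑ c, a c * y c + β := by
  rw [← he.sum_elim_eq (F := fun c => a c * y c) fun c hc => ha c (left_ne_zero_of_mul hc)]
  simp only [jetAff, padRow, Option.elim_some, Option.elim_none]
  congr 1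
  refine Finset.sum_congr rfl fun s _ => ?_
  cases hs : e s with
  | none => simp
  | some c => simp [hy s c hs]

theorem DNN.one_le_depth {L d : ℕ} (θ : DNN L d) : 1 ≤ L := by cases θ <;> omega

variable {ρ : ℝ → ℝ} (ρ₁ ρ₂ : ℝ → ℝ) {R : ℝ}

/-- A network with at most `N` nonzero parameters only uses `N` of its inputs, and all its hidden
layers may be taken of width `N`. -/
theorem DNN.exists_padded_tail (hR : 0 ≤ R) {L k : ℕ} (θ : DNN L k) :
    ∀ M, L = M + 1 → θ.numNonzeros ≤ N → θ.BoundedBy R →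
    ∃ (e : Fin N → Option (Fin k)) (w : Fin M → Fin N → Option (Fin N) → ℝ)
      (o : Option (Fin N) → ℝ), PartialInj e ∧ (∀ l t c, |w l t c| ≤ R) ∧ (∀ c, |o c| ≤ R) ∧
      ∑ l, ∑ t, ∑ c, nzInd (w l t c) + ∑ c, nzInd (o c) ≤ θ.numNonzeros ∧
      ∀ (y : Fin k → ℝ) (h : Fin N → Jet), (∀ t r, e t = some r → (h t).1 = y r) →
        (jetAff o (jetRun ρ ρ₁ ρ₂ M w h)).1 = θ.eval ρ y := by
  induction θ with
  | output W b =>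
    intro M hM hN hb
    obtain rfl : M = 0 := by omega
    rw [DNN.numNonzeros, DNN.layerNonzeros_eq] at hN ⊢
    obtain ⟨e, he, hW⟩ := exists_partialInj_columns (N := N) W
      (le_trans (Finset.sum_le_sum fun r _ => Nat.le_add_left _ _) hN)
    refine ⟨e, fun l => l.elim0, padRow e (W 0) (b 0), he, fun l => l.elim0,
      abs_padRow_le hR (hb.1 0) (hb.2 0), ?_, fun y h hy => ?_⟩
    · simpa using he.sum_nzInd_padRow_le (W 0) (b 0)
    · simp only [jetRun]
      rw [he.jetAff_padRow_fst (hW 0) _ hy]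
      simp [DNN.eval, Matrix.mulVec, dotProduct]
  | @hidden L d m W b rest ih =>
    intro M hM hN hb
    obtain ⟨M, rfl⟩ : ∃ M', M = M' + 1 := ⟨M - 1, by have := rest.one_le_depth; omega⟩
    rw [DNN.numNonzeros, DNN.layerNonzeros_eq] at hN ⊢
    obtain ⟨e', w', o, he', hw', ho, hcount, heval⟩ := ih M (by omega) (by omega) hb.2
    obtain ⟨e, he, hW⟩ := exists_partialInj_columns (N := N) W
      (le_trans (Finset.sum_le_sum fun r _ => Nat.le_add_left _ _)
        (le_trans (Nat.le_add_right _ _) hN))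
    -- Slot `t` receives the row of the neuron `e' t` which the tail reads there, and a zero row if
    -- it is empty. An empty slot may still output `ρ 0 ≠ 0`, but its value is irrelevant: `heval`
    -- constrains only the occupied slots.
    refine ⟨e, Fin.cons (fun t => (e' t).elim 0 fun r => padRow e (W r) (b r)) w', o, he, ?_, ho,
      ?_, fun y h hy => ?_⟩
    · intro l
      refine Fin.cases (fun t c => ?_) (fun l t c => ?_) l
      · cases ht : e' t with
        | none => simpa [ht] using hR
        | some r => simpa [ht] using abs_padRow_le hR (hb.1.1 r) (hb.1.2 r) c
      · simpa using hw' l t c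
    · rw [Fin.sum_univ_succ]
      simp only [Fin.cons_zero, Fin.cons_succ]
      have h1 : ∑ t, ∑ c, nzInd ((e' t).elim 0 (fun r => padRow e (W r) (b r)) c) ≤
          ∑ r, (nzInd (b r) + ∑ c, nzInd (W r c)) := by
        refine le_trans (Finset.sum_le_sum fun t _ => ?_)
          (he'.sum_elim_le fun r => nzInd (b r) + ∑ c, nzInd (W r c))
        cases ht : e' t with
        | none => simp
        | some r => simpa using he.sum_nzInd_padRow_le (W r) (b r)
      omega
    · simp only [jetRun, Fin.cons_zero, Fin.cons_succ, DNN.eval]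
      refine heval _ _ fun t r ht => ?_
      simp only [jetAct, ht, Option.elim_some]
      rw [he.jetAff_padRow_fst (hW r) _ hy]
      simp [Matrix.mulVec, dotProduct]

theorem DNN.exists_padded (hR : 0 ≤ R) {d M : ℕ} (θ : DNN (M + 2) d) (hN : θ.numNonzeros ≤ N)
    (hb : θ.BoundedBy R) : ∃ p : ParamIdx d N M → ℝ,
      (Finset.univ.filter fun i => p i ≠ 0).card ≤ N ∧ (∀ i, |p i| ≤ R) ∧
      ∀ x k, (netJet ρ ρ₁ ρ₂ p x k).1 = θ.eval ρ x := by
  cases θ with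
  | @hidden _ _ m W b rest =>
    rw [DNN.numNonzeros, DNN.layerNonzeros_eq] at hN
    obtain ⟨e, w, o, he, hw, ho, hcount, heval⟩ :=
      rest.exists_padded_tail (ρ := ρ) ρ₁ ρ₂ (N := N) hR M rfl (by omega) hb.2
    refine ⟨Sum.elim (fun q => (e q.1).elim 0 fun r => q.2.elim (b r) (W r))
      (Sum.elim (fun q => w q.1 q.2.1 q.2.2) o), ?_, ?_, fun x k => ?_⟩
    · rw [← sum_nzInd, Fintype.sum_sum_type, Fintype.sum_sum_type, Fintype.sum_prod_type,
        Fintype.sum_prod_type]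
      simp only [Sum.elim_inl, Sum.elim_inr, Fintype.sum_prod_type]
      have h1 : ∑ t, ∑ c, nzInd ((e t).elim 0 fun r => Option.elim c (b r) (W r)) ≤
          ∑ r, (nzInd (b r) + ∑ c, nzInd (W r c)) := by
        refine le_trans (Finset.sum_le_sum fun t _ => ?_)
          (he.sum_elim_le fun r => nzInd (b r) + ∑ c, nzInd (W r c))
        cases ht : e t with
        | none => simp
        | some r => simp [Fintype.sum_option]
      omega
    · rintro (⟨t, c⟩ | ⟨l, t, c⟩ | c)
      · cases ht : e t with
        | none => simpa [ht] using hR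
        | some r =>
          cases c with
          | none => simpa [ht] using hb.1.2 r
          | some c => simpa [ht] using hb.1.1 r c
      · exact hw l t c
      · exact ho c
    · simp only [netJet, Sum.elim_inr, Sum.elim_inl, DNN.eval]
      refine heval _ _ fun t r ht => ?_
      simp [firstJet, jetAct, jetAff, ht, inputJet, Matrix.mulVec, dotProduct]

/-- With at most one nonzero parameter, a network of depth at least two is constant. -/
theorem DNN.eval_eq_of_numNonzeros_le_one {d M : ℕ} (θ : DNN (M + 2) d)
    (h : θ.numNonzeros ≤ 1) (x y : Fin d → ℝ) : θ.eval ρ x = θ.eval ρ y := by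
  have hzero : ∀ {m k : ℕ} {W : Matrix (Fin m) (Fin k) ℝ} {b : Fin m → ℝ},
      DNN.layerNonzeros W b = 0 → W = 0 := fun {m k W b} hW => by
    rw [DNN.layerNonzeros_eq] at hW
    ext r c
    by_contra hne
    have h1 := Finset.single_le_sum (f := fun r => nzInd (b r) + ∑ c, nzInd (W r c))
      (fun _ _ => Nat.zero_le _) (Finset.mem_univ r)
    have h2 := Finset.single_le_sum (f := fun c => nzInd (W r c))
      (fun _ _ => Nat.zero_le _) (Finset.mem_univ c)
    have h3 := nzInd_pos hne
    omega
  cases θ with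
  | @hidden _ _ m W b rest =>
    rw [DNN.numNonzeros] at h
    change rest.eval ρ (fun i => ρ ((W.mulVec x + b) i)) =
      rest.eval ρ (fun i => ρ ((W.mulVec y + b) i))
    -- If `W = 0` the input is ignored. Otherwise the single nonzero parameter is in `W`, so the
    -- next weight matrix vanishes and forgets the input.
    by_cases hW : W = 0
    · simp [hW]
    · have h0 : 1 ≤ DNN.layerNonzeros W b := by
        by_contra hlt
        exact hW (hzero (b := b) (by omega))
      have hrest : rest.numNonzeros = 0 := by omega
      cases rest with
      | output W' b' =>
        rw [DNN.numNonzeros] at hrest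
        simp [DNN.eval, hzero hrest]
      | hidden W' b' rest' =>
        rw [DNN.numNonzeros] at hrest
        simp [DNN.eval, hzero (by omega : DNN.layerNonzeros W' b' = 0)]

end Padding

/-! ### Size of the net and numerical constants -/

section Numerics

theorem card_paramIdx (d N M : ℕ) :
    Fintype.card (ParamIdx d N M) = N * (d + 1) + (M * (N * (N + 1)) + (N + 1)) := by
  simp [ParamIdx]

/-- The leading term comes from the power `M + 2` of a power linear in `M`, hence the quadratic
dependence on `E`. Constants and `log E ≤ E` are absorbed through `log X ≥ 1 / 2`, giving `36 = 22 +
14`. -/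
theorem log_covering_bound_le {M : ℕ} {E X : ℝ} (hX2 : 2 ≤ X) (hEM : (M : ℝ) + 2 ≤ E) :
    Real.log (369 * E ^ 5 * X ^ (2 * M + 9) * (360 * E ^ 3 * X ^ (6 * M + 9)) ^ (M + 2)) ≤
      36 * E ^ 2 * Real.log X := by
  have hM' : (0 : ℝ) ≤ M := Nat.cast_nonneg M
  have hE2 : 2 ≤ E := by linarith
  have hE0 : 0 < E := by linarith
  have hX0 : 0 < X := by linarith
  rw [Real.log_mul (by positivity) (by positivity), Real.log_mul (by positivity) (by positivity),
    Real.log_mul (by positivity) (by positivity), Real.log_pow, Real.log_pow, Real.log_pow,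
    Real.log_mul (by positivity) (by positivity), Real.log_mul (by positivity) (by positivity),
    Real.log_pow, Real.log_pow]
  have hlog2 : Real.log 2 < 0.7 := Real.log_two_lt_d9.trans (by norm_num)
  have h512 : Real.log 512 ≤ 7 := by
    rw [show (512 : ℝ) = 2 ^ 9 by norm_num, Real.log_pow]
    push_cast
    linarith
  have h369 : Real.log 369 ≤ 7 := (Real.log_le_log (by norm_num) (by norm_num)).trans h512
  have h360 : Real.log 360 ≤ 7 := (Real.log_le_log (by norm_num) (by norm_num)).trans h512
  have hlogE : Real.log E ≤ E := (Real.log_le_sub_one_of_pos hE0).trans (by linarith)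
  have ha : 1 / 2 ≤ Real.log X := by
    have h1 := Real.log_two_gt_d9
    have h2 := Real.log_le_log (by norm_num) hX2
    linarith
  set a := Real.log X
  push_cast
  have hL : (M : ℝ) + 2 ≤ E := hEM
  have e1 : ((M : ℝ) + 2) * (Real.log 360 + 3 * Real.log E + (6 * M + 9) * a) ≤
      E * (7 + 3 * E + (6 * E + 9) * a) := by
    have h0 : 0 ≤ Real.log E := Real.log_nonneg (by linarith)
    have h1 : 0 ≤ Real.log 360 := Real.log_nonneg (by norm_num)
    have h2 : (6 * (M : ℝ) + 9) * a ≤ (6 * E + 9) * a := by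
      have : (M : ℝ) ≤ E := by linarith
      gcongr
    gcongr
  have e2 : (2 * (M : ℝ) + 9) * a ≤ (2 * E + 5) * a := by
    exact mul_le_mul_of_nonneg_right (by linarith) (by linarith)
  have e3 : 7 + 5 * E + E * (7 + 3 * E) ≤ 11 * E ^ 2 := by nlinarith
  have e4 : 11 * E ^ 2 ≤ 22 * E ^ 2 * a := by nlinarith
  have e5 : (2 * E + 5) + E * (6 * E + 9) ≤ 14 * E ^ 2 := by nlinarith
  have e6 : ((2 * E + 5) + E * (6 * E + 9)) * a ≤ 14 * E ^ 2 * a := by gcongr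
  linarith

theorem covering_product_le {M : ℕ} {E X G Λ I Q K : ℝ} (hE : 1 ≤ E) (hX : 1 ≤ X) (hG : 1 ≤ G)
    (hGX : G ≤ 3 * E ^ 2 * X ^ (2 * M + 4)) (hΛ1 : 1 ≤ Λ)
    (hΛX : Λ ≤ (360 * E ^ 3 * X ^ (6 * M + 9)) ^ (M + 2)) (hI : I ≤ 3 * E * X ^ 2)
    (hQ0 : 0 ≤ Q) (hQ : Q ≤ 4 * E * X ^ 2) (hK0 : 0 ≤ K) (hK : K ≤ 10 * G * E * Λ * X) :
    I * (Q * K + 1) ≤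
      369 * E ^ 5 * X ^ (2 * M + 9) * (360 * E ^ 3 * X ^ (6 * M + 9)) ^ (M + 2) := by
  have e1 : 1 ≤ E ^ 2 * X ^ 3 * G * Λ :=
    one_le_mul_of_one_le_of_one_le (one_le_mul_of_one_le_of_one_le
      (one_le_mul_of_one_le_of_one_le (one_le_pow₀ hE) (one_le_pow₀ hX)) hG) hΛ1
  have e2 : Q * K ≤ 4 * E * X ^ 2 * (10 * G * E * Λ * X) :=
    mul_le_mul hQ hK hK0 (by positivity)
  calc I * (Q * K + 1) ≤ 3 * E * X ^ 2 * (4 * E * X ^ 2 * (10 * G * E * Λ * X) + 1) :=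
        mul_le_mul hI (by linarith) (by positivity) (by positivity)
    _ = 3 * E * X ^ 2 * (40 * (E ^ 2 * X ^ 3 * G * Λ) + 1) := by ring
    _ ≤ 3 * E * X ^ 2 * (41 * (E ^ 2 * X ^ 3 * G * Λ)) :=
        mul_le_mul_of_nonneg_left (by linarith) (by positivity)
    _ = 123 * E ^ 3 * X ^ 5 * (G * Λ) := by ring
    _ ≤ 123 * E ^ 3 * X ^ 5 * ((3 * E ^ 2 * X ^ (2 * M + 4)) *
        (360 * E ^ 3 * X ^ (6 * M + 9)) ^ (M + 2)) :=
        mul_le_mul_of_nonneg_left (mul_le_mul hGX hΛX (by linarith) (by positivity))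
          (by positivity)
    _ = 369 * E ^ 5 * (X ^ 5 * X ^ (2 * M + 4)) *
        (360 * E ^ 3 * X ^ (6 * M + 9)) ^ (M + 2) := by ring
    _ = _ := by rw [← pow_add, show 5 + (2 * M + 4) = 2 * M + 9 by ring]

/-- The logarithm of the covering numbers grows logarithmically in `N R n`. -/
theorem log_covering_le {d N M n I Q : ℕ} (hd : 1 ≤ d) (hN : 1 ≤ N) (hn : 1 ≤ n) {R E G X B Λ δ : ℝ}
    (hR : 1 ≤ R) (hX : X = N * R * n) (hX2 : 2 ≤ X) (hEd : (d : ℝ) ≤ E) (hEM : (M : ℝ) + 2 ≤ E)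
    (hG : 1 ≤ G) (hGX : G ≤ 3 * E ^ 2 * X ^ (2 * M + 4))
    (hB : B = 2 * (1 + M : ℕ) * ((N * R) ^ M * R) ^ 2)
    (hI : I = N * (d + 1) + (M * (N * (N + 1)) + (N + 1))) (hQ : Q = N * n + I)
    (hΛ : Λ = (45 * (N * R * B) ^ 3) ^ (M + 2)) (hδ : δ = 1 / (2 * G * d * Λ * n)) :
    Real.log (((I + 1) *
      (Q * (2 * ⌈R / δ⌉₊ + 1) + 1) : ℕ) : ℝ) ≤
      36 * E ^ 2 * Real.log X := by
  have hd' : (1 : ℝ) ≤ d := by exact_mod_cast hd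
  have hN' : (1 : ℝ) ≤ N := by exact_mod_cast hN
  have hn' : (1 : ℝ) ≤ n := by exact_mod_cast hn
  have hM' : (0 : ℝ) ≤ M := Nat.cast_nonneg M
  have hE2 : 2 ≤ E := by linarith
  have hX1 : 1 ≤ X := by linarith
  have hNR : N * R ≤ X := by
    rw [hX]; exact le_mul_of_one_le_right (by positivity) hn'
  have hNR1 : 1 ≤ N * R := one_le_mul_of_one_le_of_one_le hN' hR
  have hNX : N ≤ X := (le_mul_of_one_le_right (by positivity) hR).trans hNR
  have hRX : R ≤ X := (le_mul_of_one_le_left (by positivity) hN').trans hNR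
  have hRn : R * n ≤ X := by
    rw [hX]
    have : 1 * (R * n) ≤ N * (R * n) := by gcongr
    linarith
  have hNn : N * n ≤ X := by
    rw [hX]
    have : N * n * 1 ≤ N * n * R := by gcongr
    linarith
  have hXX : X ≤ X ^ 2 := le_self_pow₀ hX1 (by norm_num)
  have hEX : X ^ 2 ≤ E * X ^ 2 := le_mul_of_one_le_left (by positivity) (by linarith)
  have hNN : (N : ℝ) ^ 2 ≤ X ^ 2 := by gcongr
  have hI' : (I : ℝ) + 1 ≤ 3 * E * X ^ 2 := by
    rw [hI]
    push_cast
    have e1 : (N : ℝ) * (d + 1) ≤ X ^ 2 * (E + 1) := by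
      have : (N : ℝ) ≤ X ^ 2 := by linarith
      gcongr
    have e2 : (M : ℝ) * (N * (N + 1)) ≤ (E - 2) * (2 * X ^ 2) := by
      have : (N : ℝ) * (N + 1) ≤ 2 * X ^ 2 := by linarith
      have h2 : (M : ℝ) ≤ E - 2 := by linarith
      gcongr
    linarith
  have hB0 : 1 ≤ B := by
    rw [hB]
    have h1 : 1 ≤ ((N * R) ^ M * R) ^ 2 :=
      one_le_pow₀ (one_le_mul_of_one_le_of_one_le (one_le_pow₀ hNR1) hR)
    push_cast
    exact one_le_mul_of_one_le_of_one_le (by linarith) h1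
  have hBX : B ≤ 2 * E * X ^ (2 * M + 2) := by
    rw [hB]
    have h1 : ((N * R) ^ M * R) ^ 2 ≤ X ^ (2 * M + 2) := by
      calc ((N * R) ^ M * R) ^ 2 ≤ (X ^ M * X) ^ 2 := by gcongr
        _ = _ := by ring
    have h2 : ((1 + M : ℕ) : ℝ) ≤ E := by push_cast; linarith
    gcongr
  have hZ : 1 ≤ 45 * (N * R * B) ^ 3 := by
    have : 1 ≤ (N * R * B) ^ 3 := one_le_pow₀ (one_le_mul_of_one_le_of_one_le hNR1 hB0)
    linarith
  have hΛ1 : 1 ≤ Λ := hΛ ▸ one_le_pow₀ hZ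
  have hΛX : Λ ≤ (360 * E ^ 3 * X ^ (6 * M + 9)) ^ (M + 2) := by
    rw [hΛ]
    refine pow_le_pow_left₀ (by positivity) ?_ _
    calc 45 * (N * R * B) ^ 3 ≤ 45 * (X * (2 * E * X ^ (2 * M + 2))) ^ 3 := by gcongr
      _ = _ := by ring
  have hRδ : R / δ = 2 * G * d * Λ * (R * n) := by
    rw [hδ]; field_simp
  have hRδ1 : 1 ≤ R / δ := by
    rw [hRδ]
    have h1 : 1 ≤ G * d := one_le_mul_of_one_le_of_one_le hG hd'
    have h2 : 1 ≤ G * d * Λ := one_le_mul_of_one_le_of_one_le h1 hΛ1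
    have h3 : 1 ≤ G * d * Λ * (R * n) :=
      one_le_mul_of_one_le_of_one_le h2 (one_le_mul_of_one_le_of_one_le hR hn')
    linarith
  have hRδX : R / δ ≤ 2 * G * E * Λ * X := by
    rw [hRδ]; gcongr
  have hK : (2 * (⌈R / δ⌉₊ : ℝ) + 1) ≤ 10 * G * E * Λ * X := by
    have := Nat.ceil_lt_add_one (show 0 ≤ R / δ by linarith)
    linarith
  have hQ' : (Q : ℝ) ≤ 4 * E * X ^ 2 := by
    rw [hQ]
    push_cast
    linarith
  have hY : (((I + 1) *
      (Q * (2 * ⌈R / δ⌉₊ + 1) + 1) : ℕ) : ℝ) ≤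
      369 * E ^ 5 * X ^ (2 * M + 9) * (360 * E ^ 3 * X ^ (6 * M + 9)) ^ (M + 2) := by
    push_cast
    exact covering_product_le (by linarith) hX1 hG hGX hΛ1 hΛX hI' (Nat.cast_nonneg _) hQ'
      (by positivity) hK
  exact (Real.log_le_log (by positivity) hY).trans (log_covering_bound_le hX2 hEM)

theorem sqrt_add_three_le {x y z : ℝ} (hx : 0 ≤ x) (hy : 0 ≤ y) (hz : 0 ≤ z) :
    √(x + y + z) ≤ √x + √y + √z := by
  rw [Real.sqrt_le_left (by positivity)]
  have h1 := Real.sq_sqrt hx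
  have h2 := Real.sq_sqrt hy
  have h3 := Real.sq_sqrt hz
  have h4 := mul_nonneg (Real.sqrt_nonneg x) (Real.sqrt_nonneg y)
  have h5 := mul_nonneg (Real.sqrt_nonneg x) (Real.sqrt_nonneg z)
  have h6 := mul_nonneg (Real.sqrt_nonneg y) (Real.sqrt_nonneg z)
  nlinarith

/-- Here `9` exceeds `√72 = √(2 * 36)`, and the discretization error `1 / n` accounts for the
remaining unit in `10`. This uses `log X ≥ 1 / 2`, which follows from `X ≥ 2`. -/
theorem one_div_add_sqrt_le {N n : ℕ} (hN : 1 ≤ N) (hn : 1 ≤ n) {R E G X Y : ℝ}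
    (hR : 1 ≤ R) (hX : X = N * R * n) (hX2 : 2 ≤ X) (hE : 2 ≤ E) (hG : 1 ≤ G)
    (hY : Real.log Y ≤ 36 * E ^ 2 * Real.log X) :
    1 / (n : ℝ) + G ^ 2 * √(2 * n * Real.log (Y ^ N)) / n ≤
      10 * E * G ^ 2 * √N * (n : ℝ) ^ (-(1 / 2) : ℝ) *
        (√(Real.log R) + √(Real.log N) + √(Real.log n)) := by
  have hN' : (1 : ℝ) ≤ N := by exact_mod_cast hN
  have hn' : (1 : ℝ) ≤ n := by exact_mod_cast hn
  have hn0 : (0 : ℝ) < n := by linarith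
  have ha : 1 / 2 ≤ Real.log X := by
    have h1 := Real.log_two_gt_d9
    have h2 := Real.log_le_log (by norm_num) hX2
    linarith
  have hsum : √(Real.log X) ≤ √(Real.log R) + √(Real.log N) + √(Real.log n) := by
    have : Real.log X = Real.log R + Real.log N + Real.log n := by
      rw [hX, Real.log_mul (by positivity) (by positivity),
        Real.log_mul (by positivity) (by positivity)]
      ring
    rw [this]
    exact sqrt_add_three_le (Real.log_nonneg hR) (Real.log_nonneg hN') (Real.log_nonneg hn')
  have hsn : (n : ℝ) ^ (-(1 / 2) : ℝ) = 1 / √n := by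
    rw [Real.rpow_neg hn0.le, ← Real.sqrt_eq_rpow, one_div]
  have hs0 : 0 < √(n : ℝ) := Real.sqrt_pos.2 hn0
  have hs1 : 1 ≤ √(n : ℝ) := Real.one_le_sqrt.2 hn'
  have hss : √(n : ℝ) * √n = n := Real.mul_self_sqrt hn0.le
  set a := Real.log X
  have hsa : 1 / 2 ≤ √a := Real.le_sqrt_of_sq_le (by linarith)
  have h1 : √(2 * n * Real.log (Y ^ N)) ≤ 9 * E * √n * √N * √a := by
    rw [Real.sqrt_le_left (by positivity), Real.log_pow]
    have e : (9 * E * √n * √N * √a) ^ 2 = 81 * E ^ 2 * n * N * a := by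
      rw [mul_pow, mul_pow, mul_pow, mul_pow, Real.sq_sqrt (by positivity),
        Real.sq_sqrt (by positivity), Real.sq_sqrt (by linarith)]
      ring
    rw [e]
    calc 2 * n * (N * Real.log Y) ≤ 2 * n * (N * (36 * E ^ 2 * a)) := by gcongr
      _ = 72 * (E ^ 2 * n * N * a) := by ring
      _ ≤ 81 * (E ^ 2 * n * N * a) := by
          have : 0 ≤ E ^ 2 * n * N * a := by positivity
          linarith
      _ = _ := by ring
  have h2 : 1 / (n : ℝ) ≤ 1 / √n * (2 * √a) := by
    have : 1 / (n : ℝ) ≤ 1 / √n := by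
      apply one_div_le_one_div_of_le hs0
      nlinarith
    have : 1 / √(n : ℝ) * 1 ≤ 1 / √n * (2 * √a) := by gcongr; linarith
    linarith
  have h3 : G ^ 2 * √(2 * n * Real.log (Y ^ N)) / n ≤ 1 / √n * (9 * (E * G ^ 2 * √N) * √a) := by
    calc _ ≤ G ^ 2 * (9 * E * √n * √N * √a) / n := by gcongr
      _ = G ^ 2 * (9 * E * √n * √N * √a) / (√n * √n) := by rw [hss]
      _ = _ := by field_simp
  have h4 : 2 ≤ E * G ^ 2 * √N := by
    have h5 : 1 ≤ √(N : ℝ) := Real.one_le_sqrt.2 hN'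
    have h6 : 1 ≤ G ^ 2 := one_le_pow₀ hG
    have h7 : 1 ≤ G ^ 2 * √N := one_le_mul_of_one_le_of_one_le h6 h5
    nlinarith
  rw [hsn]
  calc _ ≤ 1 / √n * (2 * √a) + 1 / √n * (9 * (E * G ^ 2 * √N) * √a) := add_le_add h2 h3
    _ = 1 / √n * √a * (2 + 9 * (E * G ^ 2 * √N)) := by ring
    _ ≤ 1 / √n * √a * (E * G ^ 2 * √N + 9 * (E * G ^ 2 * √N)) := by gcongr
    _ = 10 * E * G ^ 2 * √N * (1 / √n) * √a := by ring
    _ ≤ _ := by gcongr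

end Numerics

/-! ### Complexity of squared residuals of sparse networks -/

section NetworkClass

variable {ρ ρ₁ ρ₂ : ℝ → ℝ} {d N M : ℕ} {R : ℝ}

/-- The coefficients of the pre-activation of the `t`-th neuron of the first layer at `x`. -/
def firstCoeff (x : Fin d → ℝ) (t : Fin N) : ParamIdx d N M → ℝ :=
  Sum.elim (fun q => if q.1 = t then q.2.elim 1 x else 0) 0

theorem sum_firstCoeff (x : Fin d → ℝ) (t : Fin N) (p : ParamIdx d N M → ℝ) :
    ∑ i, firstCoeff x t i * p i = ∑ c, p (.inl (t, some c)) * x c + p (.inl (t, none)) := by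
  simp only [firstCoeff, Fintype.sum_sum_type, Sum.elim_inl, Sum.elim_inr, Fintype.sum_prod_type,
    ite_mul, zero_mul]
  rw [Finset.sum_eq_single t (fun s _ hs => by simp [hs]) (by simp)]
  simp only [if_true, Fintype.sum_option, Option.elim_none, Option.elim_some, Pi.zero_apply,
    zero_mul, Finset.sum_const_zero, add_zero, one_mul]
  rw [add_comm]
  congr 1
  exact Finset.sum_congr rfl fun c _ => mul_comm _ _

/-- Finite nets of the sparse networks, uniformly at the points of a sample. -/
theorem IsSigmoidal.exists_net_cover (H : IsSigmoidal ρ ρ₁ ρ₂) (hR : 1 ≤ R) {n : ℕ}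
    (Θ : Set (ParamIdx d N M → ℝ))
    (hs : ∀ p ∈ Θ, (Finset.univ.filter fun i => p i ≠ 0).card ≤ N) (hb : ∀ p ∈ Θ, ∀ i, |p i| ≤ R)
    {δ : ℝ} (hδ : 0 < δ) (ξ : Fin n → Fin d → ℝ) :
    ∃ T : Finset (ParamIdx d N M → ℝ), (T : Set (ParamIdx d N M → ℝ)) ⊆ Θ ∧
      T.card ≤ ((Fintype.card (ParamIdx d N M) + 1) *
        (Fintype.card ((Fin N × Fin n) ⊕ ParamIdx d N M) * (2 * ⌈R / δ⌉₊ + 1) + 1)) ^ N ∧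
      ∀ p ∈ Θ, ∃ p' ∈ T, (∀ i, |p i - p' i| ≤ δ) ∧ ∀ j t,
        |ρ (∑ c, p (.inl (t, some c)) * ξ j c + p (.inl (t, none))) -
          ρ (∑ c, p' (.inl (t, some c)) * ξ j c + p' (.inl (t, none)))| ≤ δ := by
  classical
  -- Two families of monotone functions of linear forms are covered together: `ρ` of the first-layer
  -- pre-activations at the sample, and the coordinates of the parameter. As `|ρ| ≤ 1 ≤ R`, one grid
  -- of thresholds serves both.
  obtain ⟨T, hT, hcard, hc⟩ := exists_cover_sparse
    (Sum.elim (fun s => firstCoeff (ξ s.2) s.1) (fun i => Pi.single i 1) :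
      (Fin N × Fin n) ⊕ ParamIdx d N M → ParamIdx d N M → ℝ)
    (Sum.elim (fun _ => ρ) (fun _ => id)) (by
      rintro (s | i)
      · exact H.mono
      · exact monotone_id) Θ N hs R δ hδ ⌈R / δ⌉₊
    ((div_le_iff₀ hδ).1 (Nat.le_ceil _)) (by
      rintro p hp (s | i)
      · exact (H.abs_le _).trans hR
      · simpa [Pi.single_apply] using hb p hp i)
  refine ⟨T, hT, hcard, fun p hp => ?_⟩
  obtain ⟨p', hp', h⟩ := hc p hp
  refine ⟨p', hp', fun i => ?_, fun j t => ?_⟩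
  · simpa [Pi.single_apply] using h (.inr i)
  · have := h (.inl (t, j))
    simpa only [Sum.elim_inl, sum_firstCoeff] using this

/-- Rademacher complexity of squared residuals `(Φ p x + f x)²` of sparse networks, where `Φ` is
controlled by the jets of the network. -/
theorem IsSigmoidal.rademacher_residual (H : IsSigmoidal ρ ρ₁ ρ₂) (hd : 1 ≤ d) (hN : 1 ≤ N)
    (hR : 1 ≤ R) {n : ℕ} (hn : 1 ≤ n) {μ : Measure (EuclideanSpace ℝ (Fin d))}
    (hμ : μ = 0 ∨ IsProbabilityMeasure μ) {Θ : Set (ParamIdx d N M → ℝ)} (hne : Θ.Nonempty)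
    (hs : ∀ p ∈ Θ, (Finset.univ.filter fun i => p i ≠ 0).card ≤ N) (hb : ∀ p ∈ Θ, ∀ i, |p i| ≤ R)
    {Φ : (ParamIdx d N M → ℝ) → (Fin d → ℝ) → ℝ}
    (hΦ : Continuous fun y : (ParamIdx d N M → ℝ) × (Fin d → ℝ) => Φ y.1 y.2)
    {f : EuclideanSpace ℝ (Fin d) → ℝ} (hf : AEMeasurable f μ) {S t E G : ℝ}
    (hft : ∀ᵐ x ∂μ, |f x| ≤ t) (hS : ∀ p ∈ Θ, ∀ x, |Φ p x| ≤ S)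
    (hclose : ∀ p ∈ Θ, ∀ p' ∈ Θ, ∀ x η, (∀ k, JetClose η (netJet ρ ρ₁ ρ₂ p x k)
      (netJet ρ ρ₁ ρ₂ p' x k)) → |Φ p x - Φ p' x| ≤ d * η)
    (hEd : (d : ℝ) ≤ E) (hEM : (M : ℝ) + 2 ≤ E) (hG : 1 ≤ G) (hGS : S + t ≤ G)
    (hGX : G ≤ 3 * E ^ 2 * (N * R * n) ^ (2 * M + 4)) :
    RademacherWellDefined μ n ((fun p (x : EuclideanSpace ℝ (Fin d)) =>
      (Φ p (fun i => x i) + f x) ^ 2) '' Θ) ∧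
    (2 ≤ N ∨ 2 ≤ n → rademacherComplexity μ n ((fun p (x : EuclideanSpace ℝ (Fin d)) =>
      (Φ p (fun i => x i) + f x) ^ 2) '' Θ) ≤
      10 * E * G ^ 2 * √N * (n : ℝ) ^ (-(1 / 2) : ℝ) *
        (√(Real.log R) + √(Real.log N) + √(Real.log n))) := by
  have hN' : (1 : ℝ) ≤ N := by exact_mod_cast hN
  have hn' : (1 : ℝ) ≤ n := by exact_mod_cast hn
  have hd' : (1 : ℝ) ≤ d := by exact_mod_cast hd
  have hE2 : 2 ≤ E := by linarith [(Nat.cast_nonneg M : (0 : ℝ) ≤ M)]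
  rcases hμ with rfl | hprob
  · have := rademacherWellDefined_zero (X := EuclideanSpace ℝ (Fin d)) hn
      ((fun p (x : EuclideanSpace ℝ (Fin d)) => (Φ p (fun i => x i) + f x) ^ 2) '' Θ)
    refine ⟨this.1, fun _ => this.2.trans_le ?_⟩
    positivity
  set v : (ParamIdx d N M → ℝ) → EuclideanSpace ℝ (Fin d) → ℝ :=
    fun p x => (Φ p (fun i => x i) + f x) ^ 2 with hv
  have habs : ∀ x, |f x| ≤ t → ∀ p ∈ Θ, |Φ p (fun i => x i) + f x| ≤ G := fun x hx p hp =>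
    (abs_add_le _ _).trans ((add_le_add (hS p hp _) hx).trans hGS)
  have hB : ∀ᵐ x ∂μ, ∀ p ∈ Θ, |v p x| ≤ G ^ 2 := by
    filter_upwards [hft] with x hx p hp
    rw [hv, abs_pow]
    exact pow_le_pow_left₀ (abs_nonneg _) (habs x hx p hp) 2
  have hwd : RademacherWellDefined μ n (v '' Θ) := by
    refine rademacherWellDefined_image hn hne (fun x => ?_) (fun p _ => ?_) hB
    · have : Continuous fun p => Φ p (fun i => x i) := hΦ.comp (f := fun p => (p, fun i => x i)) (by fun_prop)
      fun_prop
    · have : Continuous fun x : EuclideanSpace ℝ (Fin d) => Φ p (fun i => x i) :=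
        hΦ.comp (f := fun x : EuclideanSpace ℝ (Fin d) => (p, fun i => x i)) (by fun_prop)
      exact (this.measurable.aemeasurable.add hf).pow_const 2
  refine ⟨hwd, fun hNn => ?_⟩
  -- `X ≥ 2` keeps the logarithmic factor away from zero; when `N = R = n = 1` that factor vanishes.
  set X : ℝ := N * R * n with hX
  have hX2 : 2 ≤ X := by
    rcases hNn with h | h
    · have h : (2 : ℝ) ≤ N := by exact_mod_cast h
      have h1 : 2 * 1 * 1 ≤ (N : ℝ) * R * n := by gcongr
      linarith
    · have h : (2 : ℝ) ≤ n := by exact_mod_cast h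
      have h1 : 1 * 1 * 2 ≤ (N : ℝ) * R * n := by gcongr
      linarith
  set B : ℝ := 2 * (1 + M : ℕ) * ((N * R) ^ M * R) ^ 2 with hBdef
  set Λ : ℝ := (45 * (N * R * B) ^ 3) ^ (M + 2) with hΛ
  -- Parameters `δ`-close give jets `Λ * δ`-close and residuals `d * Λ * δ`-close. The sum of two
  -- residuals is at most `2 * G`, so the squares differ by at most `1 / n`.
  set δ : ℝ := 1 / (2 * G * d * Λ * n) with hδ
  have hB0 : 0 < B := by positivity
  have hΛ0 : 0 < Λ := by positivity
  have hδ0 : 0 < δ := by positivity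
  set Y : ℕ := (Fintype.card (ParamIdx d N M) + 1) *
    (Fintype.card ((Fin N × Fin n) ⊕ ParamIdx d N M) * (2 * ⌈R / δ⌉₊ + 1) + 1) with hY
  have hlog := log_covering_le hd hN hn hR hX hX2 hEd hEM hG hGX hBdef (card_paramIdx d N M)
    (by simp : Fintype.card ((Fin N × Fin n) ⊕ ParamIdx d N M) =
      N * n + Fintype.card (ParamIdx d N M)) hΛ hδ
  refine le_trans ?_ (one_div_add_sqrt_le hN hn hR hX hX2 hE2 hG hlog)
  have hY2 : 2 ≤ Y := by
    rw [hY, card_paramIdx]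
    nlinarith [Nat.zero_le (Fintype.card ((Fin N × Fin n) ⊕ ParamIdx d N M) *
      (2 * ⌈R / δ⌉₊ + 1)), Nat.zero_le (M * (N * (N + 1))), Nat.zero_le (N * (d + 1))]
  have hY1 : (1 : ℝ) < (Y : ℝ) ^ N :=
    one_lt_pow₀ (by exact_mod_cast hY2) (by omega)
  refine rademacherComplexity_image_le hn hne hwd (by positivity)
    (hB.and hft |>.mono fun x hx => hx.1) hY1 fun ξ hξ => ?_
  obtain ⟨T, hT, hcard, hc⟩ := H.exists_net_cover hR Θ hs hb hδ0 fun j i => ξ j i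
  refine ⟨T, hT, by exact_mod_cast hcard, fun p hp => ?_⟩
  obtain ⟨p', hp', h1, h2⟩ := hc p hp
  refine ⟨p', hp', fun j => ?_⟩
  have hG' : ∀ p ∈ Θ, |Φ p (fun i => ξ j i) + f (ξ j)| ≤ G := fun p hp => by
    have := hξ j p hp
    exact abs_le_of_sq_le_sq ((le_abs_self _).trans this) (by linarith)
  have hdiff := hclose p hp p' (hT hp') (fun i => ξ j i) _ fun k =>
    H.jetClose_netJet hR hN (hBdef.symm.le) hδ0.le (hb p hp) (hb p' (hT hp')) h1 k (h2 j)
  have hsq : v p (ξ j) - v p' (ξ j) = (Φ p (fun i => ξ j i) - Φ p' (fun i => ξ j i)) *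
      ((Φ p (fun i => ξ j i) + f (ξ j)) + (Φ p' (fun i => ξ j i) + f (ξ j))) := by
    rw [hv]; ring
  rw [hsq, abs_mul]
  calc _ ≤ (d * (Λ * δ)) * (2 * G) := by
        refine mul_le_mul hdiff ?_ (abs_nonneg _) (by positivity)
        exact (abs_add_le _ _).trans (by linarith [hG' p hp, hG' p' (hT hp')])
    _ = 1 / n := by rw [hδ]; field_simp

end NetworkClass

/-! ### The interior and boundary classes -/

section Final

theorem cond_eq_zero_or_isProbabilityMeasure {X : Type*} [MeasurableSpace X] (μ : Measure X)
    (s : Set X) : ProbabilityTheory.cond μ s = 0 ∨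
      IsProbabilityMeasure (ProbabilityTheory.cond μ s) := by
  by_cases h0 : μ s = 0
  · exact .inl (cond_eq_zero.2 (.inr h0))
  by_cases h1 : μ s = ⊤
  · exact .inl (cond_eq_zero.2 (.inl h1))
  · exact .inr (cond_isProbabilityMeasure_of_finite h0 h1)

theorem MeasureTheory.MemLp.ae_cond_abs_le {X : Type*} [MeasurableSpace X] {μ : Measure X}
    {s : Set X} {f : X → ℝ} (hf : MemLp f ⊤ (μ.restrict s)) :
    AEMeasurable f (ProbabilityTheory.cond μ s) ∧
      ∀ᵐ x ∂(ProbabilityTheory.cond μ s), |f x| ≤ (eLpNorm f ⊤ (μ.restrict s)).toReal := by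
  have hac : ProbabilityTheory.cond μ s ≪ μ.restrict s := Measure.smul_absolutelyContinuous
  refine ⟨hf.1.aemeasurable.mono_ac hac, hac.ae_le ?_⟩
  have hfin : eLpNormEssSup f (μ.restrict s) ≠ ⊤ := by
    rw [← eLpNorm_exponent_top]
    exact hf.2.ne
  filter_upwards [ae_le_eLpNormEssSup (f := f) (μ := μ.restrict s)] with x hx
  rw [eLpNorm_exponent_top, ← Real.norm_eq_abs, ← toReal_enorm]
  exact ENNReal.toReal_mono hfin hx

variable {ρ ρ₁ ρ₂ : ℝ → ℝ} {d N M : ℕ} {R : ℝ}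

/-- The sparse bounded parameters of networks of uniform width which compute functions in the
class `nnClass`. -/
def sparseParams (ρ ρ₁ ρ₂ : ℝ → ℝ) (d N M : ℕ) (R : ℝ) (k : Fin d) : Set (ParamIdx d N M → ℝ) :=
  {p | (Finset.univ.filter fun i => p i ≠ 0).card ≤ N ∧ (∀ i, |p i| ≤ R) ∧
    (fun x : EuclideanSpace ℝ (Fin d) => (netJet ρ ρ₁ ρ₂ p (fun i => x i) k).1) ∈
      nnClass ρ d (M + 2) N R}

/-- One inclusion is padding; the other is built into `sparseParams`, so padded parameters need not
be converted back into a `DNN`. This is harmless because the nets are chosen inside the parameter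
set. -/
theorem nnClass_eq_image (ρ ρ₁ ρ₂ : ℝ → ℝ) (hR : 0 ≤ R) (k : Fin d) :
    nnClass ρ d (M + 2) N R =
      (fun p (x : EuclideanSpace ℝ (Fin d)) => (netJet ρ ρ₁ ρ₂ p (fun i => x i) k).1) ''
        sparseParams ρ ρ₁ ρ₂ d N M R k := by
  ext u
  constructor
  · rintro ⟨θ, hθ, hb, rfl⟩
    obtain ⟨p, h1, h2, h3⟩ := θ.exists_padded (ρ := ρ) ρ₁ ρ₂ hR hθ hb
    have : (fun x : EuclideanSpace ℝ (Fin d) => (netJet ρ ρ₁ ρ₂ p (fun i => x i) k).1) =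
        fun x => θ.eval ρ fun i => x i := funext fun x => h3 _ k
    exact ⟨p, ⟨h1, h2, θ, hθ, hb, this⟩, this⟩
  · rintro ⟨p, ⟨-, -, h⟩, rfl⟩
    exact h

theorem DNN.exists_zero (hR : 0 ≤ R) (d : ℕ) : ∀ M : ℕ, ∃ θ : DNN (M + 1) d,
    θ.numNonzeros = 0 ∧ θ.BoundedBy R
  | 0 => ⟨.output 0 0, by simp [DNN.numNonzeros, DNN.layerNonzeros_eq],
      fun _ _ => by simpa using hR, fun _ => by simpa using hR⟩
  | M + 1 => by
      obtain ⟨θ, h1, h2⟩ := DNN.exists_zero hR d M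
      refine ⟨.hidden (0 : Matrix (Fin d) (Fin d) ℝ) 0 θ, ?_, ?_⟩
      · simp [DNN.numNonzeros, DNN.layerNonzeros_eq, h1]
      · simp [DNN.BoundedBy, h2, hR]

theorem nonempty_sparseParams (ρ ρ₁ ρ₂ : ℝ → ℝ) (hR : 0 ≤ R) (k : Fin d) :
    (sparseParams ρ ρ₁ ρ₂ d N M R k).Nonempty := by
  obtain ⟨θ, h1, h2⟩ := DNN.exists_zero hR d (M + 1)
  have : (fun x : EuclideanSpace ℝ (Fin d) => θ.eval ρ fun i => x i) ∈ nnClass ρ d (M + 2) N R :=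
    ⟨θ, h1.trans_le (Nat.zero_le _), h2, rfl⟩
  rw [nnClass_eq_image ρ ρ₁ ρ₂ hR k] at this
  obtain ⟨p, hp, -⟩ := this
  exact ⟨p, hp⟩

theorem IsSigmoidal.interiorClass_nnClass (H : IsSigmoidal ρ ρ₁ ρ₂) (hR : 0 ≤ R) (k : Fin d)
    (f : EuclideanSpace ℝ (Fin d) → ℝ) :
    interiorClass (nnClass ρ d (M + 2) N R) f =
      (fun p (x : EuclideanSpace ℝ (Fin d)) =>
        (∑ k, (netJet ρ ρ₁ ρ₂ p (fun i => x i) k).2.2 + f x) ^ 2) ''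
        sparseParams ρ ρ₁ ρ₂ d N M R k := by
  rw [nnClass_eq_image ρ ρ₁ ρ₂ hR k]
  ext u
  simp only [interiorClass, Set.exists_mem_image, H.laplacian_netJet]
  simp only [Set.mem_image, Set.mem_ofPred_eq, eq_comm]

theorem boundaryClass_nnClass (ρ ρ₁ ρ₂ : ℝ → ℝ) (hR : 0 ≤ R) (k : Fin d)
    (g : EuclideanSpace ℝ (Fin d) → ℝ) :
    boundaryClass (nnClass ρ d (M + 2) N R) g =
      (fun p (x : EuclideanSpace ℝ (Fin d)) =>
        ((netJet ρ ρ₁ ρ₂ p (fun i => x i) k).1 + (-g) x) ^ 2) ''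
        sparseParams ρ ρ₁ ρ₂ d N M R k := by
  rw [nnClass_eq_image ρ ρ₁ ρ₂ hR k]
  ext u
  simp only [boundaryClass, Set.exists_mem_image, sq_abs, sub_eq_add_neg]
  simp only [Set.mem_image, Set.mem_ofPred_eq, eq_comm, Pi.neg_apply]

/-- Settles the interior bound for `N = 1`, where the right-hand side may vanish: the networks are
constant, and a class with a single element has no positive complexity. -/
theorem interiorClass_nnClass_one (f : EuclideanSpace ℝ (Fin d) → ℝ) (hR : 0 ≤ R) :
    interiorClass (nnClass ρ d (M + 2) 1 R) f = {fun x => f x ^ 2} := by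
  have hlap : ∀ u ∈ nnClass ρ d (M + 2) 1 R, Laplacian.laplacian u = 0 := by
    rintro u ⟨θ, hθ, -, rfl⟩
    have : (fun x : EuclideanSpace ℝ (Fin d) => θ.eval ρ fun i => x i) =
        fun _ => θ.eval ρ 0 := funext fun x => θ.eval_eq_of_numNonzeros_le_one hθ _ _
    rw [this]
    exact InnerProductSpace.laplacian_const
  ext l
  simp only [interiorClass, Set.mem_ofPred_eq, Set.mem_singleton_iff]
  constructor
  · rintro ⟨u, hu, rfl⟩
    simp [hlap u hu]
  · rintro rfl
    obtain ⟨θ, h1, h2⟩ := DNN.exists_zero hR d (M + 1)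
    have hu : (fun x : EuclideanSpace ℝ (Fin d) => θ.eval ρ fun i => x i) ∈
        nnClass ρ d (M + 2) 1 R := ⟨θ, h1.trans_le (Nat.zero_le _), h2, rfl⟩
    exact ⟨_, hu, by simp [hlap _ hu]⟩

theorem rademacher_singleton_le {X : Type*} [MeasurableSpace X] {μ : Measure X}
    (hμ : μ = 0 ∨ IsProbabilityMeasure μ) {n : ℕ} (hn : 1 ≤ n) {f : X → ℝ}
    (hF : RademacherWellDefined μ n {f}) : rademacherComplexity μ n {f} ≤ 0 := by
  rcases hμ with rfl | h
  · exact (rademacherWellDefined_zero hn _).2.le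
  · exact rademacherComplexity_singleton hF

theorem IsSigmoidal.rademacher_interior (H : IsSigmoidal ρ ρ₁ ρ₂) (hd : 1 ≤ d) (hN : 1 ≤ N)
    (hR : 1 ≤ R) {n : ℕ} (hn : 1 ≤ n) (Ω : Set (EuclideanSpace ℝ (Fin d)))
    {f : EuclideanSpace ℝ (Fin d) → ℝ} (hf : MemLp f ⊤ (volume.restrict Ω)) {E : ℝ}
    (hEd : (d : ℝ) ≤ E) (hEM : (M : ℝ) + 2 ≤ E) (hEf : normInterior Ω f ≤ E) :
    RademacherWellDefined (uniformInterior Ω) n (interiorClass (nnClass ρ d (M + 2) N R) f) ∧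
    rademacherComplexity (uniformInterior Ω) n (interiorClass (nnClass ρ d (M + 2) N R) f) ≤
      90 * E ^ 5 * (n : ℝ) ^ (-(1 / 2) : ℝ) * (N : ℝ) ^ (4 * ((M + 2 : ℕ) : ℝ) - 7 / 2) *
        R ^ (4 * (M + 2)) * (√(Real.log R) + √(Real.log N) + √(Real.log n)) := by
  have hN' : (1 : ℝ) ≤ N := by exact_mod_cast hN
  have hn' : (1 : ℝ) ≤ n := by exact_mod_cast hn
  have hM' : (0 : ℝ) ≤ M := Nat.cast_nonneg M
  have hE : 2 ≤ E := by linarith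
  have hQ : 1 ≤ N * R := one_le_mul_of_one_le_of_one_le hN' hR
  have hμ := cond_eq_zero_or_isProbabilityMeasure (volume : Measure (EuclideanSpace ℝ (Fin d))) Ω
  obtain ⟨hfm, hfb⟩ := hf.ae_cond_abs_le
  -- The Laplacian is at most `2 * d * (M + 1) * R ^ 2 * (N * R) ^ (2 * M + 1)`. Raising the last
  -- exponent by one makes `G ^ 2 * √N` carry exactly `R ^ (4 * L)` and `N ^ (4 * L - 7 / 2)` for `L
  -- = M + 2`; the norm of `f` takes the third unit in `3`.
  set G : ℝ := 3 * E ^ 2 * (R ^ 2 * (N * R) ^ (2 * M + 2)) with hG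
  have hP : 1 ≤ R ^ 2 * (N * R) ^ (2 * M + 2) :=
    one_le_mul_of_one_le_of_one_le (one_le_pow₀ hR) (one_le_pow₀ hQ)
  have hEE : E ≤ E ^ 2 := le_self_pow₀ (by linarith) (by norm_num)
  have hG1 : 1 ≤ G := by
    rw [hG]
    exact one_le_mul_of_one_le_of_one_le (by linarith) hP
  have key := H.rademacher_residual (M := M) hd hN hR hn hμ
    (nonempty_sparseParams ρ ρ₁ ρ₂ (by linarith) (⟨0, hd⟩ : Fin d))
    (fun p hp => hp.1) (fun p hp => hp.2.1)
    (Φ := fun p x => ∑ k, (netJet ρ ρ₁ ρ₂ p x k).2.2)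
    (continuous_finsetSum _ fun k _ => (H.continuous_netJet k).snd.snd) hfm hfb
    (S := d * (N * R * (2 * (1 + M : ℕ) * ((N * R) ^ M * R) ^ 2))) (E := E) (G := G)
    (fun p hp x => by
      refine (Finset.abs_sum_le_sum_abs _ _).trans
        ((Finset.sum_le_sum fun k _ => H.abs_netJet_snd_le hR hN hp.2.1 x k).trans ?_)
      simp)
    (fun p hp p' hp' x η h => by
      rw [← Finset.sum_sub_distrib]
      refine (Finset.abs_sum_le_sum_abs _ _).trans
        ((Finset.sum_le_sum fun k _ => (h k).snd).trans ?_)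
      simp)
    hEd hEM hG1
    (by
      have h1 : (N * R) * (2 * (1 + M : ℕ) * ((N * R) ^ M * R) ^ 2) ≤
          2 * E * (R ^ 2 * (N * R) ^ (2 * M + 2)) := by
        have h2 : ((1 + M : ℕ) : ℝ) ≤ E := by push_cast; linarith
        have h3 : (N * R) ^ (2 * M + 1) ≤ (N * R) ^ (2 * M + 2) :=
          pow_le_pow_right₀ hQ (by omega)
        calc _ = 2 * (1 + M : ℕ) * (R ^ 2 * (N * R) ^ (2 * M + 1)) := by ring
          _ ≤ _ := by gcongr
      have h2 : d * ((N * R) * (2 * (1 + M : ℕ) * ((N * R) ^ M * R) ^ 2)) ≤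
          E * (2 * E * (R ^ 2 * (N * R) ^ (2 * M + 2))) := by gcongr
      have h3 : E ≤ E ^ 2 * (R ^ 2 * (N * R) ^ (2 * M + 2)) :=
        hEE.trans (le_mul_of_one_le_right (by positivity) hP)
      have h4 := hEf
      rw [normInterior] at h4
      rw [hG]
      linarith)
    (by
      rw [hG]
      gcongr
      have h1 : N * R ≤ N * R * n := le_mul_of_one_le_right (by positivity) hn'
      have h2 : R ≤ N * R * n := le_trans (le_mul_of_one_le_left (by positivity) hN') h1
      calc R ^ 2 * (N * R) ^ (2 * M + 2) ≤ (N * R * n) ^ 2 * (N * R * n) ^ (2 * M + 2) := by gcongr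
        _ = _ := by ring)
  rw [← H.interiorClass_nnClass (by linarith)] at key
  refine ⟨key.1, ?_⟩
  have hrhs : 0 ≤ 90 * E ^ 5 * (n : ℝ) ^ (-(1 / 2) : ℝ) * (N : ℝ) ^ (4 * ((M + 2 : ℕ) : ℝ) - 7 / 2) *
        R ^ (4 * (M + 2)) * (√(Real.log R) + √(Real.log N) + √(Real.log n)) := by positivity
  rcases hN.lt_or_eq with h2 | rfl
  · refine (key.2 (.inl h2)).trans (le_of_eq ?_)
    have hpow : (N : ℝ) ^ (4 * ((M + 2 : ℕ) : ℝ) - 7 / 2) = N ^ (4 * M + 4) * √N := by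
      rw [Real.sqrt_eq_rpow, ← Real.rpow_natCast, ← Real.rpow_add (by linarith)]
      congr 1
      push_cast
      ring
    rw [hpow, hG]
    ring
  · rw [interiorClass_nnClass_one f (by linarith)] at key ⊢
    exact (rademacher_singleton_le hμ hn key.1).trans hrhs

theorem IsSigmoidal.rademacher_boundary (H : IsSigmoidal ρ ρ₁ ρ₂) (hd : 1 ≤ d) (hN : 1 ≤ N)
    (hR : 1 ≤ R) {n : ℕ} (hn : 1 ≤ n) (hNn : 2 ≤ N ∨ 2 ≤ n) (Ω : Set (EuclideanSpace ℝ (Fin d)))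
    {g : EuclideanSpace ℝ (Fin d) → ℝ}
    (hg : MemLp g ⊤ ((surfaceMeasure d).restrict (frontier Ω))) {E : ℝ}
    (hEd : (d : ℝ) ≤ E) (hEM : (M : ℝ) + 2 ≤ E) (hEg : normBoundary Ω g ≤ E) :
    RademacherWellDefined (uniformBoundary Ω) n (boundaryClass (nnClass ρ d (M + 2) N R) g) ∧
    rademacherComplexity (uniformBoundary Ω) n (boundaryClass (nnClass ρ d (M + 2) N R) g) ≤
      90 * E ^ 3 * (n : ℝ) ^ (-(1 / 2) : ℝ) * R ^ 2 * (N : ℝ) ^ (5 / 2 : ℝ) *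
        (√(Real.log R) + √(Real.log N) + √(Real.log n)) := by
  have hN' : (1 : ℝ) ≤ N := by exact_mod_cast hN
  have hn' : (1 : ℝ) ≤ n := by exact_mod_cast hn
  have hM' : (0 : ℝ) ≤ M := Nat.cast_nonneg M
  have hd' : (1 : ℝ) ≤ d := by exact_mod_cast hd
  have hE : 2 ≤ E := by linarith
  have hQ : 1 ≤ N * R := one_le_mul_of_one_le_of_one_le hN' hR
  have hRQ : R ≤ N * R := le_mul_of_one_le_left (by linarith) hN'
  have hμ := cond_eq_zero_or_isProbabilityMeasure (surfaceMeasure d) (frontier Ω)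
  obtain ⟨hgm, hgb⟩ := hg.ae_cond_abs_le
  -- The network is bounded by `N * R + R` because its last hidden layer takes values in `[-1, 1]`.
  -- The depth therefore does not enter the powers of `N` and `R`.
  set G : ℝ := 3 * E * (N * R) with hG
  have hG1 : 1 ≤ G := one_le_mul_of_one_le_of_one_le (by linarith) hQ
  have key := H.rademacher_residual (M := M) hd hN hR hn hμ
    (nonempty_sparseParams ρ ρ₁ ρ₂ (by linarith) (⟨0, hd⟩ : Fin d))
    (fun p hp => hp.1) (fun p hp => hp.2.1)
    (Φ := fun p x => (netJet ρ ρ₁ ρ₂ p x ⟨0, hd⟩).1) (f := -g)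
    (H.continuous_netJet _).fst hgm.neg (hgb.mono fun x hx => by rwa [Pi.neg_apply, abs_neg])
    (S := N * R + R) (E := E) (G := G)
    (fun p hp x => H.abs_netJet_fst_le hR hN hp.2.1 x _)
    (fun p hp p' hp' x η h => by
      have h1 := (h ⟨0, hd⟩).val
      exact h1.trans (le_mul_of_one_le_left ((abs_nonneg _).trans h1) hd'))
    hEd hEM hG1
    (by
      have h3 : E * 1 ≤ E * (N * R) := by gcongr
      have h4 := hEg
      rw [normBoundary] at h4
      have h5 : 2 * (N * R) ≤ E * (N * R) := by gcongr
      rw [hG]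
      linarith [mul_nonneg (by linarith : (0 : ℝ) ≤ E) (by linarith : (0 : ℝ) ≤ N * R)])
    (by
      have h1 : N * R ≤ N * R * n := le_mul_of_one_le_right (by positivity) hn'
      have h2 : N * R * n ≤ (N * R * n) ^ (2 * M + 4) :=
        le_self_pow₀ (hQ.trans h1) (by omega)
      have hEE : E ≤ E ^ 2 := le_self_pow₀ (by linarith) (by norm_num)
      rw [hG]
      gcongr
      exact h1.trans h2)
  rw [← boundaryClass_nnClass _ _ _ (by linarith)] at key
  refine ⟨key.1, (key.2 hNn).trans (le_of_eq ?_)⟩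
  have hpow : (N : ℝ) ^ (5 / 2 : ℝ) = N ^ 2 * √N := by
    rw [Real.sqrt_eq_rpow, ← Real.rpow_natCast, ← Real.rpow_add (by linarith)]
    norm_num
  rw [hpow, hG]
  ring

end Final

theorem theorem5p5 (C₀ : ℝ) (hC₀ : 0 < C₀) :
    ∃ c c' : ℕ → ℝ → ℝ, PolynomialDependence c ∧ PolynomialDependence c' ∧
      ∀ (ρ : ℝ → ℝ), (ρ = Real.tanh ∨ ρ = Real.sigmoid) →
      ∀ (d : ℕ), 1 ≤ d →
      ∀ (Ω : Set (EuclideanSpace ℝ (Fin d))), IsOpen Ω →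
      ∀ (L : ℕ), 2 ≤ L → (L : ℝ) ≤ C₀ * Real.log ((d : ℝ) + 3) →
      ∀ (nL : ℕ), 1 ≤ nL →
      ∀ (R : ℝ), 1 ≤ R →
        (∀ f : EuclideanSpace ℝ (Fin d) → ℝ, MemLp f ⊤ (volume.restrict Ω) →
          ∀ n : ℕ, 1 ≤ n →
            RademacherWellDefined (uniformInterior Ω) n
              (interiorClass (nnClass ρ d L nL R) f) ∧
            rademacherComplexity (uniformInterior Ω) n
              (interiorClass (nnClass ρ d L nL R) f) ≤
              c d (normInterior Ω f) * (n : ℝ) ^ (-(1 / 2) : ℝ) *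
                (nL : ℝ) ^ (4 * (L : ℝ) - 7 / 2) * R ^ (4 * L) *
                (√(Real.log R) + √(Real.log nL) + √(Real.log n))) ∧
        (∀ g : EuclideanSpace ℝ (Fin d) → ℝ,
          MemLp g ⊤ ((surfaceMeasure d).restrict (frontier Ω)) →
          ∀ m : ℕ, 1 ≤ m → (2 ≤ nL ∨ 2 ≤ m) →
            RademacherWellDefined (uniformBoundary Ω) m
              (boundaryClass (nnClass ρ d L nL R) g) ∧
            rademacherComplexity (uniformBoundary Ω) m
              (boundaryClass (nnClass ρ d L nL R) g) ≤
              c' d (normBoundary Ω g) * (m : ℝ) ^ (-(1 / 2) : ℝ) * R ^ 2 *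
                (nL : ℝ) ^ (5 / 2 : ℝ) *
                (√(Real.log R) + √(Real.log nL) + √(Real.log m))) := by
  have hdep : ∀ k : ℕ, PolynomialDependence
      fun d t => 90 * ((2 * C₀ + 1) * (1 + (d : ℝ) + t)) ^ k := fun k =>
    ⟨90 * (2 * C₀ + 1) ^ k, k, fun d t _ => le_of_eq (by simp only [mul_pow, mul_assoc])⟩
  refine ⟨_, _, hdep 5, hdep 3, ?_⟩
  intro ρ hρ d hd Ω _ L hL hLd nL hnL R hR
  obtain ⟨ρ₁, ρ₂, H⟩ : ∃ ρ₁ ρ₂, IsSigmoidal ρ ρ₁ ρ₂ := by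
    rcases hρ with rfl | rfl
    · exact ⟨_, _, isSigmoidal_tanh⟩
    · exact ⟨_, _, isSigmoidal_sigmoid⟩
  obtain ⟨M, rfl⟩ : ∃ M, L = M + 2 := ⟨L - 2, by omega⟩
  have hd' : (1 : ℝ) ≤ d := by exact_mod_cast hd
  -- The single quantity `E = (2 * C₀ + 1) * (1 + d + t)` dominates the dimension, the depth and the
  -- norm; the depth through `log (d + 3) ≤ d + 2`. The constants are then `90 * E ^ 5` and `90 * E
  -- ^ 3`.
  have hbounds : ∀ t : ℝ, 0 ≤ t → (d : ℝ) ≤ (2 * C₀ + 1) * (1 + (d : ℝ) + t) ∧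
      (M : ℝ) + 2 ≤ (2 * C₀ + 1) * (1 + (d : ℝ) + t) ∧
      t ≤ (2 * C₀ + 1) * (1 + (d : ℝ) + t) := fun t ht => by
    have h1 : Real.log ((d : ℝ) + 3) ≤ 2 * (1 + d + t) :=
      (Real.log_le_sub_one_of_pos (by linarith)).trans (by linarith)
    have h2 : C₀ * Real.log ((d : ℝ) + 3) ≤ C₀ * (2 * (1 + d + t)) := by gcongr
    have h3 : 0 ≤ C₀ * (2 * (1 + d + t)) := by positivity
    push_cast at hLd
    refine ⟨?_, ?_, ?_⟩ <;> linarith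
  refine ⟨fun f hf n hn => ?_, fun g hg m hm hnm => ?_⟩
  · obtain ⟨h1, h2, h3⟩ := hbounds (normInterior Ω f) ENNReal.toReal_nonneg
    exact H.rademacher_interior hd hnL hR hn Ω hf h1 h2 h3
  · obtain ⟨h1, h2, h3⟩ := hbounds (normBoundary Ω g) ENNReal.toReal_nonneg
    exact H.rademacher_boundary hd hnL hR hm hnm Ω hg h1 h2 h3
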